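/- A topos means a Grothendieck topos, i.e. a category equivalent to the category of sheaves of sets on a small site. An object $A$ of a topos is called $s$-noetherian if every ascending sequence $A_1\subseteq A_2\subseteq\cdots\subseteq A$ of subobjects of $A$ stabilises. A topos is called locally $s$-noetherian if it has a family of generators $(G_i)_{i\in I}$, indexed by a set $I$, such that every $G_i$ is $s$-noetherian; here generators means that for any two morphisms $u\neq v$ from $A$ to $B$ there are $i\in I$ and $a:G_i\to A$ with $ua\neq va$. A functor $j^\bullet:\mathbf D\to\mathbf C$ is called a localisation if it commutes with all colimits and with finite limits and has a full and faithful right adjoint $j_\bullet:\mathbf C\to\mathbf D$. Let $\mathscr T_1$ and $\mathscr T_2$ be locally $s$-noetherian topoi, let $\mathscr T_0$ be a topos, and let $j_i^\bullet:\mathscr T_i\to\mathscr T_0$, $i=1,2$, be localisations. Let $\mathscr T$ be the gluing of $\mathscr T_1$ and $\mathscr T_2$ along $\mathscr T_0$: its objects are the triples $(A_1,A_2,\alpha)$ with $A_i$ an object of $\mathscr T_i$ and $\alpha:j_1^\bullet(A_1)\to j_2^\bullet(A_2)$ an isomorphism in $\mathscr T_0$, and a morphism $(A_1,A_2,\alpha)\to(B_1,B_2,\beta)$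 is a pair $(\xi_1,\xi_2)$ of morphisms $\xi_i:A_i\to B_i$ in $\mathscr T_i$ with $j_2^\bullet(\xi_2)\,\alpha=\beta\,j_1^\bullet(\xi_1)$. Let $\pi_i^\bullet:\mathscr T\to\mathscr T_i$, $i=1,2$, be the projections $\pi_i^\bullet(A_1,A_2,\alpha)=A_i$. Then $\mathscr T$ and $\mathscr T_0$ are locally $s$-noetherian topoi, and the functors $\pi_1^\bullet$ and $\pi_2^\bullet$ are localisations. -/

import Mathlib

open CategoryTheory CategoryTheory.Limits

universe v u u₀ u₁ u₂

namespace ToposGluing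

/-- A (Grothendieck) topos: a category equivalent to the category of sheaves of sets on a small
site. Sets are the terms of `Type v`, the universe in which the hom-sets live. -/
def IsTopos (T : Type u) [Category.{v} T] : Prop :=
  ∃ (S : Type v) (_ : SmallCategory S) (J : GrothendieckTopology S),
    Nonempty (T ≌ Sheaf J (Type v))

/-- A locally s-noetherian topos: a topos with a (small) family `G` of generators, each of which
satisfies the ascending chain condition on subobjects. That `G` is a family of generators means
that parallel morphisms `f g : A ⟶ B` are equal as soon as `h ≫ f = h ≫ g` for every morphism
`h : G i ⟶ A` and every `i`. -/
structure IsLocallySNoetherianTopos (T : Type u) [Category.{v} T] : Prop where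
  isTopos : IsTopos T
  exists_generators : ∃ (I : Type v) (G : I → T),
    (ObjectProperty.ofObj G).IsSeparating ∧ ∀ i, IsNoetherianObject (G i)

/-- A localisation of categories: a functor that commutes with all (small) colimits and with finite
limits, and that has a full and faithful right adjoint. -/
structure IsLocalisation {D : Type u₁} [Category.{v} D] {C : Type u₂} [Category.{v} C]
    (j : D ⥤ C) : Prop where
  preservesColimits : PreservesColimits j
  preservesFiniteLimits : PreservesFiniteLimits j
  exists_rightAdjoint : ∃ r : C ⥤ D, Nonempty (j ⊣ r) ∧ r.Full ∧ r.Faithful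

end ToposGluing

/-! Colimits and finite limits of the gluing are formed componentwise, since `j₁` and `j₂` preserve
them. If `r₂` is the right adjoint of `j₂`, then `A ↦ (A, r₂ (j₁ A))`, glued by the inverse counit,
is right adjoint to the first projection (`adjunctionFst`). Its counit is an identity, so it is
fully faithful; the second projection follows by symmetry.

The main point is a small separating family of noetherian objects (`exists_generators_gluing`). A
morphism `a : G ⟶ X.fst` from a generator of `T₁` must be completed to a morphism of the gluing. A
localisation preserves noetherian objects (`isNoetherianObject_obj`), so `j₁ G` is noetherian, and
`exists_quotientObj_lift` identifies `j₁ G ⟶ j₂ X.snd` with `j₂ b` for some `b : Q ⟶ X.snd`, where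
`Q` is a quotient of a finite coproduct of generators of `T₂`. Such `Q` are noetherian and indexed
by a set. The triples `(G, Q, β)`, with their mirror images, separate; they are noetherian because a
strict inclusion of subobjects stays strict in some component.

That the gluing is a topos follows from a Giraud-type criterion (`isTopos_of_separating`): a
separating small full subcategory carries the topology of those sieves that become locally
surjective under a conservative family of inverse image functors, and the nerve is an equivalence
onto its sheaves. Here the family consists of the two projections followed by sheaf models of `T₁`
and `T₂`. -/

namespace ToposGluing

/-! ### Sections and local surjectivity for inverse image functors -/

open Opposite

/-- The inverse image part of a geometric morphism from a category of sheaves on a small site. -/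
structure SheafInverseImage (T : Type u) [Category.{v} T] where
  /-- The underlying category of the site. -/
  site : Type v
  [category : SmallCategory site]
  /-- The topology of the site. -/
  topology : GrothendieckTopology site
  /-- The inverse image functor. -/
  functor : T ⥤ Sheaf topology (Type v)
  [isLeftAdjoint : functor.IsLeftAdjoint]
  [preservesFiniteLimits : PreservesFiniteLimits functor]

namespace SheafInverseImage

attribute [instance] category isLeftAdjoint preservesFiniteLimits

variable {T : Type u} [Category.{v} T] (Φ : SheafInverseImage T)

/-- The sections over `s` of the sheaf attached to `X`. -/
abbrev Sec (X : T) (s : Φ.site) : Type v := (Φ.functor.obj X).obj.obj (op s)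

/-- The action of a morphism on sections. -/
def push {X Y : T} (f : X ⟶ Y) {s : Φ.site} (a : Φ.Sec X s) : Φ.Sec Y s :=
  (Φ.functor.map f).hom.app (op s) a

/-- The restriction of sections. -/
def res {X : T} {s t : Φ.site} (g : t ⟶ s) (a : Φ.Sec X s) : Φ.Sec X t :=
  (Φ.functor.obj X).obj.map g.op a

variable {X Y Z : T} {r s t : Φ.site}

@[simp]
lemma push_id (a : Φ.Sec X s) : Φ.push (𝟙 X) a = a := by
  simp [push]

lemma push_comp (f : X ⟶ Y) (g : Y ⟶ Z) (a : Φ.Sec X s) :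
    Φ.push (f ≫ g) a = Φ.push g (Φ.push f a) := by
  simp [push]

@[simp]
lemma res_id (a : Φ.Sec X s) : Φ.res (𝟙 s) a = a := by
  simp [res]

lemma res_comp (f : r ⟶ t) (g : t ⟶ s) (a : Φ.Sec X s) :
    Φ.res (f ≫ g) a = Φ.res f (Φ.res g a) := by
  simp [res]

lemma res_push (f : X ⟶ Y) (g : t ⟶ s) (a : Φ.Sec X s) :
    Φ.res g (Φ.push f a) = Φ.push f (Φ.res g a) :=
  ((Φ.functor.map f).hom.naturality_apply g.op a).symm

lemma isSheaf (X : T) : Presieve.IsSheaf Φ.topology (Φ.functor.obj X).obj :=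
  (isSheaf_iff_isSheaf_of_type _ _).1 (Φ.functor.obj X).property

lemma eq_of_locally_eq {a b : Φ.Sec X s} {R : Sieve s} (hR : R ∈ Φ.topology s)
    (h : ∀ (t : Φ.site) (g : t ⟶ s), R g → Φ.res g a = Φ.res g b) : a = b :=
  ((Φ.isSheaf X).isSeparated R hR).ext fun _ _ hg => h _ _ hg

lemma functor_map_eq_iff (f g : X ⟶ Y) : Φ.functor.map f = Φ.functor.map g ↔
    ∀ (s : Φ.site) (a : Φ.Sec X s), Φ.push f a = Φ.push g a := by
  refine ⟨fun h s a => by simp [push, h], fun h => ?_⟩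
  ext s a
  exact h _ _

lemma exists_of_isPullback {W : T} {p : W ⟶ X} {q : W ⟶ Y} {f : X ⟶ Z} {g : Y ⟶ Z}
    (h : IsPullback p q f g) (a : Φ.Sec X s) (b : Φ.Sec Y s) (hab : Φ.push f a = Φ.push g b) :
    ∃ c : Φ.Sec W s, Φ.push p c = a ∧ Φ.push q c = b :=
  Types.exists_of_isPullback
    (h.map (Φ.functor ⋙ sheafToPresheaf _ _ ⋙ (evaluation _ _).obj (op s))) a b hab

lemma exists_of_equalizer [HasEqualizers T] (f g : X ⟶ Y) (a : Φ.Sec X s)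
    (h : Φ.push f a = Φ.push g a) : ∃ c : Φ.Sec (equalizer f g) s, Φ.push (equalizer.ι f g) c = a := by
  have := isLimitForkMapOfIsLimit
    (Φ.functor ⋙ sheafToPresheaf _ _ ⋙ (evaluation _ _).obj (op s)) _ (equalizerIsEqualizer f g)
  obtain ⟨c, hc⟩ := (Types.type_equalizer_iff_unique _ _).1 ⟨this⟩ a h
  exact ⟨c, hc.1⟩

/-- The sieve of those `g` for which the restriction of `a` along `g` lifts to a member of the
family `f`. -/
def liftSieve {ι : Type*} {X : ι → T} {Y : T} (f : ∀ i, X i ⟶ Y) {s : Φ.site} (a : Φ.Sec Y s) :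
    Sieve s where
  arrows t g := ∃ (i : ι) (b : Φ.Sec (X i) t), Φ.push (f i) b = Φ.res g a
  downward_closed := by
    rintro t r g ⟨i, b, hb⟩ h
    exact ⟨i, Φ.res h b, by rw [← res_push, hb, res_comp]⟩

/-- A family of morphisms is locally surjective if every section of the target lifts locally. -/
def LocallySurjective {ι : Type*} {X : ι → T} {Y : T} (f : ∀ i, X i ⟶ Y) : Prop :=
  ∀ (s : Φ.site) (a : Φ.Sec Y s), Φ.liftSieve f a ∈ Φ.topology s

lemma LocallySurjective.functor_map_eq {ι : Type*} {X : ι → T} {Y : T} {f : ∀ i, X i ⟶ Y}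
    (hf : Φ.LocallySurjective f) {Z : T} (u w : Y ⟶ Z) (h : ∀ i, f i ≫ u = f i ≫ w) :
    Φ.functor.map u = Φ.functor.map w := by
  rw [functor_map_eq_iff]
  refine fun s a => Φ.eq_of_locally_eq (hf s a) fun t g hg => ?_
  obtain ⟨i, b, hb⟩ := hg
  rw [res_push, res_push, ← hb, ← push_comp, ← push_comp, h]

/-- The image in the sheaf attached to `Y` of a family of morphisms to `Y`. -/
def imageSubfunctor {ι : Type*} {X : ι → T} {Y : T} (f : ∀ i, X i ⟶ Y) :
    Subfunctor (Φ.functor.obj Y).obj where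
  obj s := {a | ∃ (i : ι) (b : Φ.Sec (X i) s.unop), Φ.push (f i) b = a}
  map := by
    rintro s t g a ⟨i, b, rfl⟩
    exact ⟨i, Φ.res g.unop b, (Φ.res_push (f i) g.unop b).symm⟩

/-- The sheafified image of the family includes into `Φ Y` by a monomorphism. It is also epi: maps
out of `Φ Y` that agree on it have transposes that agree on every `f k`. Sheaf categories are
balanced, so the image is everything. -/
lemma locallySurjective_of_jointlyEpi {ι : Type*} {X : ι → T} {Y : T} (f : ∀ i, X i ⟶ Y)
    (hf : ∀ {Z : T} (u w : Y ⟶ Z), (∀ i, f i ≫ u = f i ≫ w) → u = w) :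
    Φ.LocallySurjective f := by
  let U := (Φ.imageSubfunctor f).sheafify Φ.topology
  let V : Sheaf Φ.topology (Type v) :=
    ⟨U.toFunctor, (isSheaf_iff_isSheaf_of_type _ _).2 (Subfunctor.sheafify_isSheaf _ (Φ.isSheaf Y))⟩
  let i : V ⟶ Φ.functor.obj Y := ⟨U.ι⟩
  have hmono : Mono i := (sheafToPresheaf _ _).mono_of_mono_map
    (inferInstanceAs (Mono U.ι))
  have hepi : Epi i := by
    refine ⟨fun {H} u w huw => ?_⟩
    apply ((Adjunction.ofIsLeftAdjoint Φ.functor).homEquiv _ _).injective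
    refine hf _ _ fun k => ?_
    rw [← Adjunction.homEquiv_naturality_left, ← Adjunction.homEquiv_naturality_left]
    congr 1
    ext s b
    have hb : Φ.push (f k) b ∈ U.obj s := Subfunctor.le_sheafify _ _ _ ⟨k, b, rfl⟩
    exact ConcreteCategory.congr_hom (congr_arg (fun q => q.hom.app s) huw) ⟨_, hb⟩
  have hiso : IsIso i := isIso_of_mono_of_epi i
  intro s a
  have hsurj : Function.Surjective (i.hom.app (op s)) := by
    have : IsIso (i.hom.app (op s)) := inferInstanceAs
      (IsIso ((sheafToPresheaf _ _ ⋙ (evaluation _ _).obj (op s)).map i))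
    exact ((isIso_iff_bijective _).1 this).2
  obtain ⟨⟨b, hb⟩, rfl⟩ := hsurj a
  exact hb

end SheafInverseImage

end ToposGluing
-- The nerve of a separating subcategory and its induced topology
namespace ToposGluing

open Opposite

namespace SheafInverseImage

variable {T : Type u} [Category.{v} T] (Φ : SheafInverseImage T)

lemma liftSieve_pullback {ι : Type*} {X : ι → T} {Y : T} (f : ∀ i, X i ⟶ Y) {s t : Φ.site}
    (a : Φ.Sec Y s) (g : t ⟶ s) : (Φ.liftSieve f a).pullback g = Φ.liftSieve f (Φ.res g a) := by
  ext r h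
  simp [liftSieve, res_comp]

lemma liftSieve_mem_of_locally {ι : Type*} {X : ι → T} {Y : T} (f : ∀ i, X i ⟶ Y) {s : Φ.site}
    (a : Φ.Sec Y s) {R : Sieve s} (hR : R ∈ Φ.topology s)
    (h : ∀ (t : Φ.site) (g : t ⟶ s), R g → Φ.liftSieve f (Φ.res g a) ∈ Φ.topology t) :
    Φ.liftSieve f a ∈ Φ.topology s :=
  Φ.topology.transitive hR _ fun t g hg => by
    rw [liftSieve_pullback]
    exact h t g hg

end SheafInverseImage

section

variable {T : Type u} [Category.{v} T] {C : Type v} [SmallCategory C] (ι : C ⥤ T)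

/-- The functor sending `X` to the restriction along `ι` of the presheaf represented by `X`. -/
abbrev nerve : T ⥤ Cᵒᵖ ⥤ Type v := yoneda ⋙ (Functor.whiskeringLeft _ _ _).obj ι.op

lemma nerve_isRightAdjoint [HasColimitsOfSize.{v, v} T] : (nerve ι).IsRightAdjoint := by
  let e : Presheaf.restrictedULiftYoneda.{v} ι ≅ nerve ι :=
    NatIso.ofComponents (fun X => NatIso.ofComponents (fun c => Equiv.ulift.toIso))
  exact ⟨_, ⟨(Presheaf.uliftYonedaAdjunction _
    (uliftYoneda.{v}.leftKanExtensionUnit ι)).ofNatIsoRight e⟩⟩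

/-- A functor is separating if its values form a separating family. -/
def IsSeparatingFunctor : Prop :=
  ∀ ⦃X Y : T⦄ (f g : X ⟶ Y), (∀ (c : C) (h : ι.obj c ⟶ X), h ≫ f = h ≫ g) → f = g

variable {ι} in
lemma IsSeparatingFunctor.locallySurjective (hι : IsSeparatingFunctor ι)
    (Φ : SheafInverseImage T) (X : T) :
    Φ.LocallySurjective (fun p : Σ c, (ι.obj c ⟶ X) => p.2) :=
  Φ.locallySurjective_of_jointlyEpi _ fun u w h => hι u w fun c h' => h ⟨c, h'⟩

-- Substitute for pullbacks in `C`: the pullback of `p` and `q` exists only in `T`, but maps from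
-- objects of `C` cover it locally, and fullness makes the legs arrows of `C`.
variable {ι} in
lemma IsSeparatingFunctor.exists_cover_pullback [HasPullbacks T] [ι.Full]
    (hι : IsSeparatingFunctor ι) (Φ : SheafInverseImage T) {Z : T} {c d : C} (p : ι.obj c ⟶ Z)
    (q : ι.obj d ⟶ Z) {s : Φ.site} (a : Φ.Sec (ι.obj c) s) (b : Φ.Sec (ι.obj d) s)
    (hab : Φ.push p a = Φ.push q b) :
    ∃ R ∈ Φ.topology s, ∀ (t : Φ.site) (g : t ⟶ s), R.arrows g →
      ∃ (e : C) (m₁ : e ⟶ c) (m₂ : e ⟶ d) (w : Φ.Sec (ι.obj e) t),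
        ι.map m₁ ≫ p = ι.map m₂ ≫ q ∧ Φ.push (ι.map m₁) w = Φ.res g a ∧
          Φ.push (ι.map m₂) w = Φ.res g b := by
  obtain ⟨z, rfl, rfl⟩ := Φ.exists_of_isPullback (IsPullback.of_hasPullback p q) a b hab
  refine ⟨_, hι.locallySurjective Φ _ s z, ?_⟩
  rintro t g ⟨⟨e, m⟩, w, hw⟩
  obtain ⟨m₁, hm₁⟩ := ι.map_surjective (m ≫ pullback.fst _ _)
  obtain ⟨m₂, hm₂⟩ := ι.map_surjective (m ≫ pullback.snd _ _)
  refine ⟨e, m₁, m₂, w, ?_, ?_, ?_⟩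
  · rw [hm₁, hm₂, Category.assoc, Category.assoc, pullback.condition]
  · rw [hm₁, SheafInverseImage.push_comp, hw, SheafInverseImage.res_push]
  · rw [hm₂, SheafInverseImage.push_comp, hw, SheafInverseImage.res_push]

variable {ι} in
lemma IsSeparatingFunctor.exists_cover_equalizer [HasEqualizers T] [ι.Full] [ι.Faithful]
    (hι : IsSeparatingFunctor ι) (Φ : SheafInverseImage T) {c d : C} (p q : c ⟶ d)
    {s : Φ.site} (a : Φ.Sec (ι.obj c) s) (ha : Φ.push (ι.map p) a = Φ.push (ι.map q) a) :
    ∃ R ∈ Φ.topology s, ∀ (t : Φ.site) (g : t ⟶ s), R.arrows g →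
      ∃ (e : C) (m : e ⟶ c) (w : Φ.Sec (ι.obj e) t),
        m ≫ p = m ≫ q ∧ Φ.push (ι.map m) w = Φ.res g a := by
  obtain ⟨z, rfl⟩ := Φ.exists_of_equalizer _ _ a ha
  refine ⟨_, hι.locallySurjective Φ _ s z, ?_⟩
  rintro t g ⟨⟨e, m⟩, w, hw⟩
  obtain ⟨m₁, hm₁⟩ := ι.map_surjective (m ≫ equalizer.ι _ _)
  refine ⟨e, m₁, w, ?_, ?_⟩
  · apply ι.map_injective
    rw [Functor.map_comp, Functor.map_comp, hm₁, Category.assoc, Category.assoc,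
      equalizer.condition]
  · rw [hm₁, SheafInverseImage.push_comp, hw, SheafInverseImage.res_push]

/-- The topology on `C` whose covering sieves are those that become locally surjective in all the
sheaf categories under consideration. -/
def inducedTopology [HasPullbacks T] [ι.Full] [ι.Faithful] (hι : IsSeparatingFunctor ι) {K : Type*}
    (Φ : K → SheafInverseImage T) : GrothendieckTopology C where
  sieves c := {S | ∀ k, (Φ k).LocallySurjective
    (fun p : Σ d, {g : d ⟶ c // S.arrows g} => ι.map p.2.1)}
  top_mem' c k s a := by
    refine (Φ k).topology.superset_covering ?_ ((Φ k).topology.top_mem s)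
    intro t g _
    exact ⟨⟨c, 𝟙 c, trivial⟩, (Φ k).res g a, by simp⟩
  pullback_stable' c c' S h hS k s a := by
    refine (Φ k).liftSieve_mem_of_locally _ a (hS k s ((Φ k).push (ι.map h) a)) ?_
    rintro t g ⟨⟨d, f, hf⟩, b, hb⟩
    rw [SheafInverseImage.res_push] at hb
    -- The section lies locally in the fibre product of `f ∈ S` and `h`. On an object of `C` mapping
    -- to it, the leg to `c'` composed with `h` factors through `f`, hence lies in `S`.
    obtain ⟨R, hR, h'⟩ := hι.exists_cover_pullback (Φ k) (ι.map f) (ι.map h) b _ hb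
    refine (Φ k).topology.superset_covering ?_ hR
    intro r g' hg'
    obtain ⟨e, m₁, m₂, w, hm, -, hw⟩ := h' r g' hg'
    rw [← Functor.map_comp, ← Functor.map_comp] at hm
    refine ⟨⟨e, m₂, ?_⟩, w, hw⟩
    change S.arrows (m₂ ≫ h)
    rw [← ι.map_injective hm]
    exact S.downward_closed hf m₁
  transitive' c S hS R hR k s a := by
    refine (Φ k).liftSieve_mem_of_locally _ a (hS k s a) ?_
    rintro t g ⟨⟨d, f, hf⟩, b, hb⟩
    refine (Φ k).topology.superset_covering ?_ (hR hf k t b)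
    rintro r g' ⟨⟨e, m, hm⟩, w, hw⟩
    refine ⟨⟨e, m ≫ f, hm⟩, w, ?_⟩
    dsimp only at hw hb ⊢
    rw [Functor.map_comp, SheafInverseImage.push_comp, hw, ← SheafInverseImage.res_push, hb]

variable {ι} {L : (Cᵒᵖ ⥤ Type v) ⥤ T} (adj : L ⊣ nerve ι)

/-- The canonical morphism to `L.obj F` given by an element of `F`. -/
def elementMap {F : Cᵒᵖ ⥤ Type v} {c : C} (x : F.obj (op c)) : ι.obj c ⟶ L.obj F :=
  (adj.unit.app F).app (op c) x

lemma elementMap_map {F : Cᵒᵖ ⥤ Type v} {c d : C} (h : d ⟶ c) (x : F.obj (op c)) :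
    elementMap adj (F.map h.op x) = ι.map h ≫ elementMap adj x :=
  (adj.unit.app F).naturality_apply h.op x

lemma elementMap_homEquiv_symm {F : Cᵒᵖ ⥤ Type v} {X : T} (φ : F ⟶ (nerve ι).obj X) {c : C}
    (x : F.obj (op c)) :
    elementMap adj x ≫ (adj.homEquiv F X).symm φ = φ.app (op c) x := by
  obtain ⟨ψ, rfl⟩ := (adj.homEquiv F X).surjective φ
  rw [Equiv.symm_apply_apply, adj.homEquiv_unit]
  rfl

/-- The transpose of a morphism out of `L.obj F` is its list of composites with the element maps. -/
lemma elementMap_jointlyEpi {F : Cᵒᵖ ⥤ Type v} {X : T} (u w : L.obj F ⟶ X)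
    (h : ∀ (p : Σ c : C, F.obj (op c)), elementMap adj p.2 ≫ u = elementMap adj p.2 ≫ w) :
    u = w := by
  apply (adj.homEquiv _ _).injective
  ext c x
  rw [adj.homEquiv_unit, adj.homEquiv_unit]
  exact h ⟨c.unop, x⟩

lemma locallySurjective_elementMap (Φ : SheafInverseImage T) (F : Cᵒᵖ ⥤ Type v) :
    Φ.LocallySurjective (fun p : Σ c : C, F.obj (op c) => elementMap adj p.2) :=
  Φ.locallySurjective_of_jointlyEpi _ fun u w h => elementMap_jointlyEpi adj u w h

end

end ToposGluing
-- Conservative families; nerves are sheaves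
namespace ToposGluing

open Opposite

section

/-- A family of functors jointly reflects isomorphisms. -/
def IsConservativeFamily {T : Type u} [Category.{v} T] {K : Type*} (Φ : K → SheafInverseImage T) :
    Prop :=
  ∀ ⦃X Y : T⦄ (f : X ⟶ Y), (∀ k, IsIso ((Φ k).functor.map f)) → IsIso f

lemma isIso_of_locally_bijective {C : Type v} [SmallCategory C] {J : GrothendieckTopology C}
    {F G : Sheaf J (Type v)} (f : F ⟶ G)
    (hinj : ∀ (c : C) (x y : F.obj.obj (op c)), f.hom.app (op c) x = f.hom.app (op c) y →
      ∃ R ∈ J c, ∀ (d : C) (h : d ⟶ c), R.arrows h → F.obj.map h.op x = F.obj.map h.op y)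
    (hsurj : ∀ (c : C) (y : G.obj.obj (op c)), ∃ R ∈ J c, ∀ (d : C) (h : d ⟶ c), R.arrows h →
      ∃ x : F.obj.obj (op d), f.hom.app (op d) x = G.obj.map h.op y) : IsIso f := by
  have : Sheaf.IsLocallySurjective f := ⟨fun {c} y => by
    obtain ⟨R, hR, h⟩ := hsurj c y
    exact J.superset_covering (fun d g hg => h d g hg) hR⟩
  have hm (c : Cᵒᵖ) : Mono (f.hom.app c) := by
    rw [mono_iff_injective]
    intro x y hxy
    obtain ⟨R, hR, h⟩ := hinj c.unop x y hxy
    exact (((isSheaf_iff_isSheaf_of_type _ _).1 F.property).isSeparated R hR).ext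
      fun _ _ hg => h _ _ hg
  have : Mono f := (sheafToPresheaf _ _).mono_of_mono_map (NatTrans.mono_of_mono_app f.hom)
  exact isIso_of_mono_of_epi f

namespace SheafInverseImage

variable {T : Type u} [Category.{v} T] (Φ : SheafInverseImage T)

lemma isIso_functor_map {X Y : T} (f : X ⟶ Y)
    (hinj : ∀ (s : Φ.site) (a b : Φ.Sec X s), Φ.push f a = Φ.push f b → a = b)
    (hsurj : Φ.LocallySurjective (fun _ : Unit => f)) : IsIso (Φ.functor.map f) := by
  refine isIso_of_locally_bijective _ (fun s a b h => ?_) (fun s a => ?_)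
  · obtain rfl := hinj s a b h
    exact ⟨⊤, Φ.topology.top_mem s, fun _ _ _ => rfl⟩
  · exact ⟨_, hsurj s a, fun t g hg => ⟨_, hg.choose_spec.choose_spec⟩⟩

end SheafInverseImage

variable {T : Type u} [Category.{v} T] {C : Type v} [SmallCategory C] {ι : C ⥤ T}
  {L : (Cᵒᵖ ⥤ Type v) ⥤ T} (adj : L ⊣ nerve ι) {K : Type*} {Φ : K → SheafInverseImage T}

/-- A subpresheaf of a nerve whose elements cover `X` reflects to `X`. For injectivity after `Φ k`,
two sections come locally from elements `x`, `y`; if their images in `X` agree, they lift to a fibre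
product covered by objects of `C`, where `x` and `y` restrict to the same element because `φ` is
injective. Taking `φ = 𝟙` gives the counit; covering sieves give the sheaf condition. -/
lemma isIso_homEquiv_symm [HasPullbacks T] [ι.Full] (hι : IsSeparatingFunctor ι)
    (hΦ : IsConservativeFamily Φ) {F : Cᵒᵖ ⥤ Type v} {X : T} (φ : F ⟶ (nerve ι).obj X)
    (hφ : ∀ (c : C) (x y : F.obj (op c)), φ.app (op c) x = φ.app (op c) y → x = y)
    (hsurj : ∀ k, (Φ k).LocallySurjective
      (fun p : Σ c : C, F.obj (op c) => (φ.app (op p.1) p.2 : ι.obj p.1 ⟶ X))) :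
    IsIso ((adj.homEquiv F X).symm φ) := by
  refine hΦ _ fun k => (Φ k).isIso_functor_map _ ?_ ?_
  · intro s a b hab
    refine (Φ k).eq_of_locally_eq ((Φ k).topology.intersection_covering
      (locallySurjective_elementMap adj (Φ k) F s a)
      (locallySurjective_elementMap adj (Φ k) F s b)) ?_
    rintro t g ⟨⟨⟨c, x⟩, a', ha⟩, ⟨⟨d, y⟩, b', hb⟩⟩
    dsimp only at ha hb
    have h : (Φ k).push (φ.app (op c) x : ι.obj c ⟶ X) a' =
        (Φ k).push (φ.app (op d) y : ι.obj d ⟶ X) b' := by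
      rw [← elementMap_homEquiv_symm adj, ← elementMap_homEquiv_symm adj,
        SheafInverseImage.push_comp, SheafInverseImage.push_comp, ha, hb,
        ← SheafInverseImage.res_push, ← SheafInverseImage.res_push, hab]
    obtain ⟨R, hR, h'⟩ := hι.exists_cover_pullback (Φ k) _ _ a' b' h
    refine (Φ k).eq_of_locally_eq hR fun r g' hg' => ?_
    obtain ⟨e, m₁, m₂, w, hm, hw₁, hw₂⟩ := h' r g' hg'
    have hxy : F.map m₁.op x = F.map m₂.op y := by
      apply hφ
      rw [φ.naturality_apply, φ.naturality_apply]
      exact hm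
    rw [← ha, ← hb, SheafInverseImage.res_push, SheafInverseImage.res_push, ← hw₁, ← hw₂,
      ← SheafInverseImage.push_comp, ← SheafInverseImage.push_comp, ← elementMap_map,
      ← elementMap_map, hxy]
  · intro s a
    refine (Φ k).topology.superset_covering ?_ (hsurj k s a)
    rintro t g ⟨⟨c, x⟩, b, hb⟩
    refine ⟨(), (Φ k).push (elementMap adj x) b, ?_⟩
    rw [← SheafInverseImage.push_comp, elementMap_homEquiv_symm, ← hb]

include adj in
lemma isIso_counit [HasPullbacks T] [ι.Full] (hι : IsSeparatingFunctor ι)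
    (hΦ : IsConservativeFamily Φ) : IsIso adj.counit := by
  have (X : T) : IsIso (adj.counit.app X) := by
    rw [← adj.homEquiv_symm_id]
    refine isIso_homEquiv_symm adj hι hΦ (𝟙 _) (fun _ _ _ h => h) fun k => ?_
    exact hι.locallySurjective (Φ k) X
  exact NatIso.isIso_of_isIso_app _

-- A covering sieve of `c`, viewed inside the nerve of `ι.obj c`, reflects to `ι.obj c`. Matching
-- families in the nerve of `X` are therefore the same as morphisms `ι.obj c ⟶ X`.
include adj in
lemma isSheaf_nerve [HasPullbacks T] [ι.Full] [ι.Faithful] (hι : IsSeparatingFunctor ι)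
    (hΦ : IsConservativeFamily Φ) (X : T) :
    Presieve.IsSheaf (inducedTopology ι hι Φ) ((nerve ι).obj X) := by
  intro c S hS
  rw [Presieve.isSheafFor_iff_yonedaSheafCondition]
  intro f
  let φ : S.functor ⟶ (nerve ι).obj (ι.obj c) :=
    { app d := ↾fun h => ι.map h.1
      naturality d d' g := by
        ext h
        exact ι.map_comp g.unop h.1 }
  have hiso : IsIso ((adj.homEquiv _ _).symm φ) := by
    refine isIso_homEquiv_symm adj hι hΦ φ (fun d x y h => Subtype.ext (ι.map_injective h)) ?_
    intro k
    exact hS k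
  have key (u : ι.obj c ⟶ X) : S.functorInclusion ≫ yonedaEquiv.symm u = f ↔
      (adj.homEquiv _ _).symm φ ≫ u = (adj.homEquiv _ _).symm f := by
    have h₁ : S.functorInclusion ≫ yonedaEquiv.symm u = f ↔
        ∀ (d : C) (h : S.functor.obj (op d)), ι.map h.1 ≫ u = f.app (op d) h := by
      refine ⟨fun H d h => ?_, fun H => ?_⟩
      · rw [← H]
        rfl
      · ext d h
        exact H d.unop h
    rw [h₁]
    refine ⟨fun H => elementMap_jointlyEpi adj _ _ fun p => ?_, fun H d h => ?_⟩
    · rw [elementMap_homEquiv_symm, ← H, ← Category.assoc, elementMap_homEquiv_symm]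
      rfl
    · rw [← elementMap_homEquiv_symm adj, ← H, ← Category.assoc, elementMap_homEquiv_symm]
      rfl
  generalize (adj.homEquiv S.functor (ι.obj c)).symm φ = θ at hiso key
  refine ⟨(yonedaEquiv (X := c) (F := (nerve ι).obj X)).symm
    (inv θ ≫ (adj.homEquiv _ _).symm f : ι.obj c ⟶ X),
    (key _).2 (IsIso.hom_inv_id_assoc θ _), fun g hg => ?_⟩
  obtain ⟨u, rfl⟩ := yonedaEquiv.symm.surjective g
  rw [← (key u).1 hg, IsIso.inv_hom_id_assoc]

end

end ToposGluing
-- Equality of sections of the sheaf attached to `L.obj F`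
namespace ToposGluing

open Opposite

section

variable {T : Type u} [Category.{v} T] {C : Type v} [SmallCategory C] (ι : C ⥤ T)

/-- A section of the sheaf attached to `ι.obj c`, together with an element of `F` over `c`. -/
structure LabelledSection (Φ : SheafInverseImage T) (F : Cᵒᵖ ⥤ Type v) (s : Φ.site) where
  /-- The object over which the element lives. -/
  obj : C
  /-- The element. -/
  element : F.obj (op obj)
  /-- The section. -/
  sec : Φ.Sec (ι.obj obj) s

namespace LabelledSection

variable {ι} {Φ : SheafInverseImage T} {F : Cᵒᵖ ⥤ Type v} {r s t : Φ.site}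

/-- Restriction of labelled sections. -/
def res (g : t ⟶ s) (p : LabelledSection ι Φ F s) : LabelledSection ι Φ F t :=
  ⟨p.obj, p.element, Φ.res g p.sec⟩

lemma res_comp (g : r ⟶ t) (h : t ⟶ s) (p : LabelledSection ι Φ F s) :
    p.res (g ≫ h) = (p.res h).res g := by
  simp [res, SheafInverseImage.res_comp]

/-- Two labelled sections are linked if they come from a common labelled section. -/
def Linked (p q : LabelledSection ι Φ F s) : Prop :=
  ∃ (e : C) (m₁ : e ⟶ p.obj) (m₂ : e ⟶ q.obj) (w : Φ.Sec (ι.obj e) s),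
    F.map m₁.op p.element = F.map m₂.op q.element ∧
      Φ.push (ι.map m₁) w = p.sec ∧ Φ.push (ι.map m₂) w = q.sec

lemma Linked.refl (p : LabelledSection ι Φ F s) : p.Linked p :=
  ⟨p.obj, 𝟙 _, 𝟙 _, p.sec, rfl, by simp, by simp⟩

lemma Linked.symm {p q : LabelledSection ι Φ F s} (h : p.Linked q) : q.Linked p := by
  obtain ⟨e, m₁, m₂, w, h, h₁, h₂⟩ := h
  exact ⟨e, m₂, m₁, w, h.symm, h₂, h₁⟩

lemma Linked.res {p q : LabelledSection ι Φ F s} (h : p.Linked q) (g : t ⟶ s) :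
    (p.res g).Linked (q.res g) := by
  obtain ⟨e, m₁, m₂, w, h, h₁, h₂⟩ := h
  exact ⟨e, m₁, m₂, Φ.res g w, h, (Φ.res_push _ g w).symm.trans (congr_arg (Φ.res g) h₁),
    (Φ.res_push _ g w).symm.trans (congr_arg (Φ.res g) h₂)⟩

/-- The sieve over which two labelled sections are linked. -/
def linkedSieve (p q : LabelledSection ι Φ F s) : Sieve s where
  arrows t g := (p.res g).Linked (q.res g)
  downward_closed h g := by
    rw [res_comp, res_comp]
    exact h.res g

lemma linkedSieve_pullback (p q : LabelledSection ι Φ F s) (g : t ⟶ s) :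
    (p.linkedSieve q).pullback g = (p.res g).linkedSieve (q.res g) := by
  ext r h
  change Linked _ _ ↔ Linked _ _
  rw [res_comp, res_comp]

lemma linkedSieve_mem_of_locally {p q : LabelledSection ι Φ F s} {R : Sieve s}
    (hR : R ∈ Φ.topology s)
    (h : ∀ (t : Φ.site) (g : t ⟶ s), R.arrows g →
      (p.res g).linkedSieve (q.res g) ∈ Φ.topology t) :
    p.linkedSieve q ∈ Φ.topology s :=
  Φ.topology.transitive hR _ fun t g hg => by
    rw [linkedSieve_pullback]
    exact h t g hg

lemma Linked.linkedSieve_mem {p q : LabelledSection ι Φ F s} (h : p.Linked q) :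
    p.linkedSieve q ∈ Φ.topology s :=
  Φ.topology.superset_covering (fun _ g _ => h.res g) (Φ.topology.top_mem s)

/-- Links compose only locally: the two linking objects meet in a fibre product that is merely
covered by objects of `C`. This is why the equivalence relation asks for a covering sieve of links.
-/
lemma Linked.trans [HasPullbacks T] [ι.Full] [ι.Faithful] (hι : IsSeparatingFunctor ι)
    {p q r : LabelledSection ι Φ F s} (h : p.Linked q) (h' : q.Linked r) :
    p.linkedSieve r ∈ Φ.topology s := by
  obtain ⟨e, m₁, m₂, w, h, h₁, h₂⟩ := h
  obtain ⟨e', m₁', m₂', w', h', h₁', h₂'⟩ := h'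
  obtain ⟨R, hR, H⟩ := hι.exists_cover_pullback Φ (ι.map m₂) (ι.map m₁') w w' (by rw [h₂, h₁'])
  refine Φ.topology.superset_covering (fun t g hg => ?_) hR
  obtain ⟨d, n₁, n₂, z, hn, hz₁, hz₂⟩ := H t g hg
  rw [← Functor.map_comp, ← Functor.map_comp] at hn
  have hn' := ι.map_injective hn
  refine ⟨d, n₁ ≫ m₁, n₂ ≫ m₂', z, ?_, ?_, ?_⟩
  · change F.map (n₁ ≫ m₁).op p.element = F.map (n₂ ≫ m₂').op r.element
    rw [op_comp, op_comp, F.map_comp_apply, F.map_comp_apply, h, ← h', ← F.map_comp_apply,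
      ← F.map_comp_apply, ← op_comp, ← op_comp, hn']
  · change Φ.push (ι.map (n₁ ≫ m₁)) z = Φ.res g p.sec
    rw [Functor.map_comp, Φ.push_comp, hz₁, ← Φ.res_push, h₁]
  · change Φ.push (ι.map (n₂ ≫ m₂')) z = Φ.res g r.sec
    rw [Functor.map_comp, Φ.push_comp, hz₂, ← Φ.res_push, h₂']

/-- Labelled sections that are locally linked are equivalent. -/
def setoid [HasPullbacks T] [ι.Full] [ι.Faithful] (hι : IsSeparatingFunctor ι)
    (Φ : SheafInverseImage T) (F : Cᵒᵖ ⥤ Type v) (s : Φ.site) :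
    Setoid (LabelledSection ι Φ F s) where
  r p q := p.linkedSieve q ∈ Φ.topology s
  iseqv :=
    { refl p := (Linked.refl p).linkedSieve_mem
      symm h := Φ.topology.superset_covering (fun _ _ hg => Linked.symm hg) h
      trans h h' := linkedSieve_mem_of_locally
        (Φ.topology.intersection_covering h h') fun _ _ hg => Linked.trans hι hg.1 hg.2 }

/-- The presheaf of labelled sections up to local links. -/
def presheaf [HasPullbacks T] [ι.Full] [ι.Faithful] (hι : IsSeparatingFunctor ι)
    (Φ : SheafInverseImage T) (F : Cᵒᵖ ⥤ Type v) : Φ.siteᵒᵖ ⥤ Type v where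
  obj s := Quotient (setoid hι Φ F s.unop)
  map {s t} g := ↾(Quotient.map (sa := setoid hι Φ F s.unop) (sb := setoid hι Φ F t.unop)
    (LabelledSection.res g.unop) (fun p q h => by
    change linkedSieve _ _ ∈ _
    rw [← linkedSieve_pullback]
    exact Φ.topology.pullback_stable _ h))
  map_id s := by
    ext x
    obtain ⟨p, rfl⟩ := Quotient.exists_rep x
    refine congr_arg (Quotient.mk _) ?_
    simp [res]
  map_comp f g := by
    ext x
    obtain ⟨p, rfl⟩ := Quotient.exists_rep x
    exact congr_arg (Quotient.mk _) (res_comp _ _ _)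

/-- The class of a labelled section. -/
def toPresheaf [HasPullbacks T] [ι.Full] [ι.Faithful] (hι : IsSeparatingFunctor ι) {c : C}
    (x : F.obj (op c)) : (Φ.functor.obj (ι.obj c)).obj ⟶ presheaf hι Φ F where
  app s := ↾fun a => Quotient.mk (setoid hι Φ F s.unop) ⟨c, x, a⟩
  naturality s t g := by
    ext a
    rfl

/-- The class of a labelled section in the sheafification. -/
noncomputable def toSheaf [HasPullbacks T] [ι.Full] [ι.Faithful] (hι : IsSeparatingFunctor ι)
    {c : C} (x : F.obj (op c)) : Φ.functor.obj (ι.obj c) ⟶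
      (presheafToSheaf Φ.topology (Type v)).obj (presheaf hι Φ F) :=
  ⟨toPresheaf hι x ≫ toSheafify Φ.topology _⟩

lemma toSheaf_map [HasPullbacks T] [ι.Full] [ι.Faithful] (hι : IsSeparatingFunctor ι) {c d : C}
    (x : F.obj (op c)) (h : d ⟶ c) :
    toSheaf (Φ := Φ) hι (F.map h.op x) = Φ.functor.map (ι.map h) ≫ toSheaf hι x := by
  have : toPresheaf (Φ := Φ) hι (F.map h.op x) =
      (Φ.functor.map (ι.map h)).hom ≫ toPresheaf hι x := by
    ext s a
    refine Quotient.sound (s := setoid hι Φ F s.unop) (Linked.linkedSieve_mem ?_)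
    refine ⟨d, 𝟙 d, h, a, by simp, by simp, rfl⟩
  ext : 1
  change toPresheaf hι _ ≫ _ = (Φ.functor.map (ι.map h)).hom ≫ toPresheaf hι x ≫ _
  rw [this, Category.assoc]

end LabelledSection

variable {ι} {L : (Cᵒᵖ ⥤ Type v) ⥤ T} (adj : L ⊣ nerve ι)

/-- Let `Q` be the sheaf of labelled sections modulo local links. The class maps are compatible with
restriction in `F`, so two adjunctions turn them into one morphism `Φ (L F) ⟶ Q`. Sections equal in
`Φ (L F)` are thus equal in `Q`, so their classes agree locally before sheafification, which means
that they are locally linked. -/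
lemma linkedSieve_mem_of_push_elementMap_eq [HasPullbacks T] [ι.Full] [ι.Faithful]
    (hι : IsSeparatingFunctor ι) (Φ : SheafInverseImage T) {F : Cᵒᵖ ⥤ Type v} {s : Φ.site}
    (p q : LabelledSection ι Φ F s)
    (h : Φ.push (elementMap adj p.element) p.sec = Φ.push (elementMap adj q.element) q.sec) :
    p.linkedSieve q ∈ Φ.topology s := by
  let adj' := Adjunction.ofIsLeftAdjoint Φ.functor
  let Q := (presheafToSheaf Φ.topology (Type v)).obj (LabelledSection.presheaf hι Φ F)
  let ψ : F ⟶ (nerve ι).obj (Φ.functor.rightAdjoint.obj Q) :=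
    { app c := ↾fun x => adj'.homEquiv _ _ (LabelledSection.toSheaf hι x)
      naturality c d g := by
        ext x
        change adj'.homEquiv _ _ (LabelledSection.toSheaf hι (F.map g.unop.op x)) = ι.map g.unop ≫ _
        rw [LabelledSection.toSheaf_map, adj'.homEquiv_naturality_left]
        rfl }
  let ψ' : Φ.functor.obj (L.obj F) ⟶ Q := (adj'.homEquiv _ _).symm ((adj.homEquiv _ _).symm ψ)
  have hψ (c : C) (x : F.obj (op c)) :
      Φ.functor.map (elementMap adj x) ≫ ψ' = LabelledSection.toSheaf hι x := by
    rw [← adj'.homEquiv_naturality_left_symm, elementMap_homEquiv_symm]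
    exact (adj'.homEquiv _ _).symm_apply_apply _
  have hψ' (p : LabelledSection ι Φ F s) : (LabelledSection.toSheaf hι p.element).hom.app (op s)
      p.sec = ψ'.hom.app (op s) (Φ.push (elementMap adj p.element) p.sec) := by
    rw [← hψ]
    rfl
  have h₁ : (toSheafify Φ.topology (LabelledSection.presheaf hι Φ F)).app (op s)
      ((LabelledSection.toPresheaf hι p.element).app (op s) p.sec) =
      (toSheafify Φ.topology (LabelledSection.presheaf hι Φ F)).app (op s)
      ((LabelledSection.toPresheaf hι q.element).app (op s) q.sec) :=
    (hψ' p).trans ((congr_arg _ h).trans (hψ' q).symm)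
  refine LabelledSection.linkedSieve_mem_of_locally
    (Presheaf.equalizerSieve_mem Φ.topology (toSheafify Φ.topology _) _ _ h₁) fun t g hg => ?_
  exact Quotient.exact (s := LabelledSection.setoid hι Φ F t) hg

end

end ToposGluing
-- The recognition principle for topoi
namespace ToposGluing

open Opposite

section

variable {T : Type u} [Category.{v} T] {C : Type v} [SmallCategory C] {ι : C ⥤ T}
  {L : (Cᵒᵖ ⥤ Type v) ⥤ T} (adj : L ⊣ nerve ι) {K : Type*} {Φ : K → SheafInverseImage T}

lemma equalizer_mem_of_elementMap_eq [HasFiniteLimits T] [ι.Full] [ι.Faithful]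
    (hι : IsSeparatingFunctor ι) {F : Cᵒᵖ ⥤ Type v} {c : C} (x y : F.obj (op c))
    (h : elementMap adj x = elementMap adj y) :
    Presheaf.equalizerSieve (F := F) (X := op c) x y ∈ inducedTopology ι hι Φ c := by
  intro k s a
  let p : LabelledSection ι (Φ k) F s := ⟨c, x, a⟩
  let q : LabelledSection ι (Φ k) F s := ⟨c, y, a⟩
  refine (Φ k).liftSieve_mem_of_locally _ a
    (linkedSieve_mem_of_push_elementMap_eq adj hι (Φ k) p q (by simp [p, q, h])) ?_
  rintro t g ⟨e, m₁, m₂, w, h', h₁, h₂⟩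
  -- The link may use different arrows `m₁`, `m₂` to `c`. Both send `w` to the same section, so `w`
  -- lifts to their equalizer, which is covered by objects of `C`; there `x` and `y` have equal
  -- restrictions.
  obtain ⟨R, hR, H⟩ := hι.exists_cover_equalizer (Φ k) m₁ m₂ w (h₁.trans h₂.symm)
  refine (Φ k).topology.superset_covering (fun r g' hg' => ?_) hR
  obtain ⟨d, n, z, hn, hz⟩ := H r g' hg'
  refine ⟨⟨d, n ≫ m₁, ?_⟩, z, ?_⟩
  · change F.map (n ≫ m₁).op x = F.map (n ≫ m₁).op y
    conv_rhs => rw [hn]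
    exact (F.map_comp_apply m₁.op n.op x).trans
      ((congr_arg _ h').trans (F.map_comp_apply m₂.op n.op y).symm)
  · change (Φ k).push (ι.map (n ≫ m₁)) z = _
    rw [Functor.map_comp, SheafInverseImage.push_comp, hz, ← SheafInverseImage.res_push]
    exact congr_arg _ h₁

lemma imageSieve_unit_mem [HasFiniteLimits T] [ι.Full] [ι.Faithful]
    (hι : IsSeparatingFunctor ι) {F : Cᵒᵖ ⥤ Type v} {c : C} (u : ι.obj c ⟶ L.obj F) :
    Presheaf.imageSieve (adj.unit.app F) (U := c) u ∈ inducedTopology ι hι Φ c := by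
  intro k s a
  refine (Φ k).liftSieve_mem_of_locally _ a
    (locallySurjective_elementMap adj (Φ k) F s ((Φ k).push u a)) ?_
  rintro t g ⟨⟨d, x⟩, b, hb⟩
  rw [SheafInverseImage.res_push] at hb
  obtain ⟨R, hR, H⟩ := hι.exists_cover_pullback (Φ k) (elementMap adj x) u b _ hb
  refine (Φ k).topology.superset_covering (fun r g' hg' => ?_) hR
  obtain ⟨e, m₁, m₂, z, hm, -, hz⟩ := H r g' hg'
  refine ⟨⟨e, m₂, F.map m₁.op x, ?_⟩, z, hz⟩
  exact (elementMap_map adj m₁ x).trans hm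

/-- A recognition principle for topoi: a cocomplete category with finite limits and a small
separating family is a topos if it has a jointly conservative family of inverse image functors to
categories of sheaves on small sites. -/
lemma isTopos_of_separating [HasColimitsOfSize.{v, v} T] [HasFiniteLimits T] [ι.Full] [ι.Faithful]
    (hι : IsSeparatingFunctor ι) (hΦ : IsConservativeFamily Φ) : IsTopos T := by
  have := nerve_isRightAdjoint ι
  let adj := Adjunction.ofIsRightAdjoint (nerve ι)
  have := isIso_counit adj hι hΦ
  let hN := adj.fullyFaithfulROfIsIsoCounit
  let J := inducedTopology ι hι Φ
  have hsh (X : T) : Presheaf.IsSheaf J ((nerve ι).obj X) :=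
    (isSheaf_iff_isSheaf_of_type _ _).2 (isSheaf_nerve adj hι hΦ X)
  let N : T ⥤ Sheaf J (Type v) := ObjectProperty.lift _ (nerve ι) hsh
  have : N.Full := ⟨fun f => ⟨hN.preimage f.hom, by
    ext : 1
    exact hN.map_preimage f.hom⟩⟩
  have : N.Faithful := ⟨fun h => hN.map_injective (congr_arg (fun q => q.hom) h)⟩
  -- For a sheaf `F` the unit is a locally injective and locally surjective morphism of sheaves,
  -- hence an isomorphism.
  have : N.EssSurj := ⟨fun F => by
    let f : F ⟶ N.obj ((nerve ι).leftAdjoint.obj F.obj) := ⟨adj.unit.app F.obj⟩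
    have : IsIso f := by
      refine isIso_of_locally_bijective f (fun c x y hxy => ?_) (fun c y => ?_)
      · exact ⟨_, equalizer_mem_of_elementMap_eq adj hι x y hxy, fun _ _ h => h⟩
      · exact ⟨_, imageSieve_unit_mem adj hι y, fun _ _ h => h⟩
    exact ⟨_, ⟨(asIso f).symm⟩⟩⟩
  have : N.IsEquivalence := { }
  exact ⟨C, inferInstance, J, ⟨N.asEquivalence⟩⟩

end

lemma isTopos_of_isSeparating {T : Type u} [Category.{v} T] [HasColimitsOfSize.{v, v} T]
    [HasFiniteLimits T] {K : Type*} {Φ : K → SheafInverseImage T} (hΦ : IsConservativeFamily Φ)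
    {I : Type v} (G : I → T) (hG : (ObjectProperty.ofObj G).IsSeparating) : IsTopos T := by
  -- The full subcategory on `G` is small, as `I` and the hom-sets lie in `Type v`.
  refine isTopos_of_separating (C := InducedCategory T G) (ι := inducedFunctor G)
    (fun X Y f g h => hG f g ?_) hΦ
  rintro _ ⟨i⟩ h'
  exact h i h'

end ToposGluing
-- Jointly epimorphic families and noetherian objects in a topos
namespace ToposGluing

open Opposite

section

/-- A family of morphisms with a common target is jointly epimorphic. -/
def JointlyEpi {T : Type u} [Category.{v} T] {K : Type*} {X : K → T} {Y : T}
    (f : ∀ k, X k ⟶ Y) : Prop :=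
  ∀ ⦃Z : T⦄ (a b : Y ⟶ Z), (∀ k, f k ≫ a = f k ≫ b) → a = b

namespace JointlyEpi

variable {T : Type u₁} [Category.{v} T] {K : Type*} {X : K → T} {Y : T} {f : ∀ k, X k ⟶ Y}

lemma map_of_adjunction (hf : JointlyEpi f) {D : Type u₂} [Category.{v} D] {j : T ⥤ D} {r : D ⥤ T}
    (adj : j ⊣ r) : JointlyEpi (fun k => j.map (f k)) := by
  intro Z a b h
  apply (adj.homEquiv _ _).injective
  refine hf _ _ fun k => ?_
  rw [← adj.homEquiv_naturality_left, ← adj.homEquiv_naturality_left, h]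

lemma comp_epi (hf : JointlyEpi f) {Z : T} (g : Y ⟶ Z) [Epi g] :
    JointlyEpi (fun k => f k ≫ g) := by
  intro W a b h
  rw [← cancel_epi g]
  exact hf _ _ fun k => by simpa using h k

lemma epi_of_factors (hf : JointlyEpi f) {Z : T} (g : Z ⟶ Y) (h : ∀ k, ∃ p, p ≫ g = f k) :
    Epi g := by
  refine ⟨fun a b hab => hf _ _ fun k => ?_⟩
  obtain ⟨p, hp⟩ := h k
  rw [← hp, Category.assoc, Category.assoc, hab]

lemma sigma_ι_comp {K : Type*} (X : K → T) [HasCoproduct X] {Y : T} (p : ∐ X ⟶ Y) [Epi p] :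
    JointlyEpi (fun k => Sigma.ι X k ≫ p) := by
  intro Z a b h
  rw [← cancel_epi p]
  exact Sigma.hom_ext _ _ fun k => by simpa using h k

end JointlyEpi

namespace IsTopos

variable {T : Type u} [Category.{v} T] (hT : IsTopos T)

include hT

lemma hasColimits : HasColimitsOfSize.{v, v} T := by
  obtain ⟨S, _, J, ⟨e⟩⟩ := hT
  have : HasColimitsOfSize.{v, v} (Sheaf J (Type v)) := ⟨fun K _ => inferInstance⟩
  exact Adjunction.has_colimits_of_equivalence e.functor

lemma hasLimits : HasLimitsOfSize.{v, v} T := by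
  obtain ⟨S, _, J, ⟨e⟩⟩ := hT
  exact Adjunction.has_limits_of_equivalence e.functor

lemma exists_sheafInverseImage : ∃ Φ : SheafInverseImage T, Φ.functor.IsEquivalence := by
  obtain ⟨S, _, J, ⟨e⟩⟩ := hT
  have : e.functor.IsLeftAdjoint := e.toAdjunction.isLeftAdjoint
  exact ⟨⟨S, J, e.functor⟩, inferInstance⟩

lemma balanced : Balanced T := by
  obtain ⟨S, _, J, ⟨e⟩⟩ := hT
  refine ⟨fun f _ _ => ?_⟩
  have : IsIso (e.functor.map f) := isIso_of_mono_of_epi _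
  exact isIso_of_reflects_iso f e.functor

lemma isRegularEpiCategory : IsRegularEpiCategory T := by
  have := hT.hasLimits
  have : HasFiniteLimits T := hasFiniteLimits_of_hasLimitsOfSize T
  obtain ⟨S, _, J, ⟨e⟩⟩ := hT
  refine ⟨fun f _ => ?_⟩
  have := IsRegularEpiCategory.regularEpiOfEpi (e.functor.map f)
  rw [isRegularEpi_iff_effectiveEpi] at this ⊢
  exact e.functor.effectiveEpi_of_map f this

/-- In a sheaf model, jointly epimorphic families are locally surjective, and local lifts of
sections pass to pullbacks. -/
lemma jointlyEpi_of_isPullback [HasPullbacks T] {K : Type*} {X : K → T} {Y : T} {f : ∀ k, X k ⟶ Y}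
    (hf : JointlyEpi f) {W : T} (g : W ⟶ Y) {P : K → T} {p : ∀ k, P k ⟶ W} {q : ∀ k, P k ⟶ X k}
    (h : ∀ k, IsPullback (p k) (q k) g (f k)) : JointlyEpi p := by
  obtain ⟨Φ, hΦ⟩ := hT.exists_sheafInverseImage
  have hp : Φ.LocallySurjective p := by
    intro s a
    refine Φ.topology.superset_covering ?_ (Φ.locallySurjective_of_jointlyEpi f
      (fun u w h => hf u w h) s (Φ.push g a))
    rintro t i ⟨k, b, hb⟩
    rw [Φ.res_push] at hb
    obtain ⟨z, hz, -⟩ := Φ.exists_of_isPullback (h k) _ b hb.symm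
    exact ⟨k, z, hz⟩
  exact fun Z a b hab => Φ.functor.map_injective (hp.functor_map_eq Φ a b hab)

lemma regular : Regular T := by
  have := hT.hasLimits
  have := hT.hasColimits
  have : HasFiniteLimits T := hasFiniteLimits_of_hasLimitsOfSize T
  have : HasFiniteColimits T := hasFiniteColimits_of_hasColimitsOfSize T
  have := hT.isRegularEpiCategory
  refine { hasCoequalizer_of_isKernelPair := fun _ => inferInstance
           regularEpiIsStableUnderBaseChange := ⟨fun {X Y Y' S f g f' g'} sq hg => ?_⟩ }
  have hg : IsRegularEpi g := hg
  have : Epi g' := by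
    have hj : JointlyEpi (fun _ : Unit => g) := fun Z a b h => by
      rw [← cancel_epi g]
      exact h ()
    have := hT.jointlyEpi_of_isPullback hj f (fun _ => sq.flip)
    exact ⟨fun a b h => this a b fun _ => h⟩
  exact IsRegularEpiCategory.regularEpiOfEpi g'

end IsTopos

section Noetherian

lemma wellFoundedGT_of_jointly_injective {α : Type*} [PartialOrder α] {K : Type*} [Finite K]
    {A : K → Type*} [∀ k, PartialOrder (A k)] [∀ k, WellFoundedGT (A k)] (φ : ∀ k, α →o A k)
    (h : ∀ a b, a ≤ b → (∀ k, φ k a = φ k b) → a = b) : WellFoundedGT α := by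
  rw [wellFoundedGT_iff_monotone_chain_condition]
  intro f
  choose n hn using fun k => wellFoundedGT_iff_monotone_chain_condition.1
    (inferInstanceAs (WellFoundedGT (A k))) ((φ k).comp f)
  have := Fintype.ofFinite K
  have hle (k : K) : n k ≤ Finset.univ.sup n := Finset.le_sup (Finset.mem_univ k)
  refine ⟨Finset.univ.sup n, fun m hm => h _ _ (f.monotone hm) fun k => ?_⟩
  exact (hn k _ (hle k)).symm.trans (hn k _ ((hle k).trans hm))

/-- Nested subobjects `S ≤ S'` with the same pullbacks along all `f k` coincide: the base change of
the family to `S'` is jointly epi and factors through `S`, so the inclusion is mono and epi. -/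
lemma IsTopos.isNoetherianObject_of_jointlyEpi {T : Type u} [Category.{v} T] (hT : IsTopos T)
    {K : Type*} [Finite K] {X : K → T} {Y : T} {f : ∀ k, X k ⟶ Y} (hf : JointlyEpi f)
    (hX : ∀ k, IsNoetherianObject (X k)) : IsNoetherianObject Y := by
  have := hT.hasLimits
  have : HasFiniteLimits T := hasFiniteLimits_of_hasLimitsOfSize T
  have := hT.balanced
  refine ⟨wellFoundedGT_of_jointly_injective
    (fun k => ⟨(Subobject.pullback (f k)).obj, (Subobject.pullback (f k)).monotone⟩) ?_⟩
  intro S S' hle h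
  refine le_antisymm hle ?_
  have : Epi (Subobject.ofLE S S' hle) := by
    refine (hT.jointlyEpi_of_isPullback hf S'.arrow
      (fun k => IsPullback.of_hasPullback S'.arrow (f k))).epi_of_factors _ fun k => ?_
    have h₁ : ((Subobject.pullback (f k)).obj S).Factors (pullback.snd S'.arrow (f k)) := by
      have : (Subobject.pullback (f k)).obj S = (Subobject.pullback (f k)).obj S' := h k
      rw [this, Limits.pullback_factors_iff, ← pullback.condition]
      exact Subobject.factors_comp_arrow _
    rw [Limits.pullback_factors_iff, ← pullback.condition] at h₁
    refine ⟨S.factorThru _ h₁, ?_⟩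
    rw [← cancel_mono S'.arrow]
    simp
  have : IsIso (Subobject.ofLE S S' hle) := isIso_of_mono_of_epi _
  exact Subobject.le_of_comm (inv (Subobject.ofLE S S' hle)) (by simp)

/-- Noetherian objects are quasi-compact: choose a finite subfamily with maximal image. Adjoining
any `f k` does not enlarge the image, so every `f k` factors through it. -/
lemma exists_fin_jointlyEpi {T : Type u} [Category.{v} T] [Regular T] [HasFiniteCoproducts T]
    {K : Type*} {X : K → T} {Y : T} [IsNoetherianObject Y] {f : ∀ k, X k ⟶ Y} (hf : JointlyEpi f) :
    ∃ (n : ℕ) (φ : Fin n → K), JointlyEpi (fun i => f (φ i)) := by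
  let U (q : Σ n : ℕ, (Fin n → K)) : Subobject Y := imageSubobject (Sigma.desc fun i => f (q.2 i))
  obtain ⟨_, ⟨⟨n, φ⟩, rfl⟩, hmax⟩ := (wellFounded_gt (α := Subobject Y)).has_min (Set.range U)
    ⟨_, ⟨0, Fin.elim0⟩, rfl⟩
  refine ⟨n, φ, ?_⟩
  have hepi : Epi (U ⟨n, φ⟩).arrow := by
    refine hf.epi_of_factors _ fun k => ?_
    let ψ : Fin (n + 1) → K := Fin.cons k φ
    have hle : U ⟨n, φ⟩ ≤ U ⟨n + 1, ψ⟩ := by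
      let θ : (∐ fun i => X (φ i)) ⟶ ∐ fun i => X (ψ i) :=
        Sigma.desc (fun i => Sigma.ι (fun i => X (ψ i)) i.succ)
      have hθ : θ ≫ Sigma.desc (fun i => f (ψ i)) = Sigma.desc (fun i => f (φ i)) := by
        refine Sigma.hom_ext _ _ fun i => ?_
        rw [← Category.assoc]
        refine (congr_arg (· ≫ _) (Sigma.ι_desc _ _)).trans ?_
        exact (Sigma.ι_desc (f := fun i => X (ψ i)) (fun i => f (ψ i)) i.succ).trans
          (Sigma.ι_desc (f := fun i => X (φ i)) (fun i => f (φ i)) i).symm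
      have hle' := imageSubobject_comp_le θ (Sigma.desc (fun i => f (ψ i)))
      rw [hθ] at hle'
      exact hle'
    have heq : U ⟨n + 1, ψ⟩ = U ⟨n, φ⟩ :=
      (eq_of_le_of_not_lt hle (hmax _ ⟨⟨n + 1, ψ⟩, rfl⟩)).symm
    have : (U ⟨n + 1, ψ⟩).Factors (f k) := by
      have h := imageSubobject_factors_comp_self (f := Sigma.desc fun i => f (ψ i))
        (Sigma.ι (fun i => X (ψ i)) 0)
      rw [colimit.ι_desc] at h
      exact h
    rw [heq] at this
    exact ⟨_, Subobject.factorThru_arrow _ _ this⟩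
  have hepi' : Epi (Sigma.desc fun i => f (φ i)) := by
    rw [← imageSubobject_arrow_comp (Sigma.desc fun i => f (φ i))]
    exact epi_comp _ _
  have := JointlyEpi.sigma_ι_comp (fun i => X (φ i)) (Sigma.desc fun i => f (φ i))
  simpa using this

end Noetherian

end

end ToposGluing
-- Localisations preserve noetherian objects
namespace ToposGluing

open Opposite

section Localisation

variable {X₁ : Type u₁} [Category.{v} X₁] {X₀ : Type u₀} [Category.{v} X₀] {j : X₁ ⥤ X₀}
  {r : X₀ ⥤ X₁} (adj : j ⊣ r)

/-- As `r` is fully faithful, `j` inverts the unit. Pulling `r.map d` back along the unit therefore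
gives an object over `X` whose localisation is `D` over `j.obj X`. -/
lemma isIso_map_pullback_fst [HasPullbacks X₁] [HasPullbacks X₀] [PreservesFiniteLimits j]
    [r.Full] [r.Faithful] {D : X₀} {X : X₁} (d : D ⟶ j.obj X) :
    IsIso (j.map (pullback.fst (r.map d) (adj.unit.app X)) ≫ adj.counit.app D) := by
  have : IsIso (j.map (adj.unit.app X)) := by
    have : IsIso (j.map (adj.unit.app X) ≫ adj.counit.app (j.obj X)) :=
      (adj.left_triangle_components X).symm ▸ IsIso.id _
    exact IsIso.of_isIso_comp_right _ (adj.counit.app (j.obj X))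
  have sq := (IsPullback.of_hasPullback (r.map d) (adj.unit.app X)).map j
  have : IsIso (j.map (pullback.fst (r.map d) (adj.unit.app X))) := sq.isIso_fst_of_isIso
  infer_instance

lemma map_pullback_fst_comp [HasPullbacks X₁] {D : X₀} {X : X₁} (d : D ⟶ j.obj X) :
    (j.map (pullback.fst (r.map d) (adj.unit.app X)) ≫ adj.counit.app D) ≫ d =
      j.map (pullback.snd (r.map d) (adj.unit.app X)) := by
  have h := congr_arg (fun q => j.map q ≫ adj.counit.app _)
    (pullback.condition (f := r.map d) (g := adj.unit.app X))
  simpa using h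

-- Pulling `r S` back along the unit embeds the subobjects of `j.obj X` into those of `X`: applying
-- `j` recovers `S`.
include adj in
lemma isNoetherianObject_obj [HasPullbacks X₁] [HasPullbacks X₀] [PreservesFiniteLimits j]
    [r.Full] [r.Faithful] (X : X₁) [IsNoetherianObject X] : IsNoetherianObject (j.obj X) := by
  have hr : PreservesLimits r := adj.rightAdjoint_preservesLimits
  let φ : Subobject (j.obj X) →o Subobject X :=
    { toFun S := Subobject.mk (pullback.snd (r.map S.arrow) (adj.unit.app X))
      monotone' S S' h := by
        refine Subobject.mk_le_mk_of_comm (pullback.lift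
          (pullback.fst _ _ ≫ r.map (Subobject.ofLE S S' h)) (pullback.snd _ _) ?_)
          (pullback.lift_snd _ _ _)
        rw [Category.assoc, ← r.map_comp, Subobject.ofLE_arrow, pullback.condition] }
  refine ⟨wellFoundedGT_of_jointly_injective (fun _ : Unit => φ) fun S S' _ h => ?_⟩
  have key (S : Subobject (j.obj X)) : S = Subobject.mk (j.map (φ S).arrow) := by
    have := isIso_map_pullback_fst adj S.arrow
    let e := asIso (j.map (pullback.fst (r.map S.arrow) (adj.unit.app X)) ≫
      adj.counit.app (S : X₀))
    have he : e.hom ≫ S.arrow = j.map (pullback.snd (r.map S.arrow) (adj.unit.app X)) :=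
      map_pullback_fst_comp adj S.arrow
    conv_lhs => rw [← Subobject.mk_arrow S]
    refine Subobject.mk_eq_mk_of_comm _ _ (e.symm ≪≫ j.mapIso (Subobject.underlyingIso _).symm) ?_
    have hu : (Subobject.underlyingIso _).inv ≫ (φ S).arrow =
        pullback.snd (r.map S.arrow) (adj.unit.app X) := Subobject.underlyingIso_arrow _
    rw [Iso.trans_hom, Iso.symm_hom, Functor.mapIso_hom, Category.assoc, ← j.map_comp,
      Iso.symm_hom, hu, ← he, Iso.inv_hom_id_assoc]
  rw [key S, key S', show φ S = φ S' from h ()]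

end Localisation

/-! ### A small family of noetherian quotients -/

section NoetherianFamily

variable {T : Type u} [Category.{v} T] {I : Type v} (G : I → T)

/-- The indices for the quotients of the finite coproducts of members of a family. -/
abbrev QuotientIndex [HasFiniteCoproducts T] [HasFiniteProducts T] [WellPowered.{v} T] :
    Type v :=
  Σ (q : Σ n : ℕ, (Fin n → I)),
    Shrink.{v} (Subobject ((∐ fun i => G (q.2 i)) ⨯ (∐ fun i => G (q.2 i))))

variable [HasFiniteCoproducts T] [HasFiniteProducts T] [WellPowered.{v} T] [HasCoequalizers T]

/-- The coequalizer of a relation on a finite coproduct of members of a family. -/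
noncomputable def quotientObj (q : QuotientIndex G) : T :=
  coequalizer (((equivShrink _).symm q.2).arrow ≫ prod.fst)
    (((equivShrink _).symm q.2).arrow ≫ prod.snd)

lemma isNoetherianObject_quotientObj (hT : IsTopos T) (hG : ∀ i, IsNoetherianObject (G i))
    (q : QuotientIndex G) : IsNoetherianObject (quotientObj G q) :=
  hT.isNoetherianObject_of_jointlyEpi
    (JointlyEpi.sigma_ι_comp (fun i => G (q.1.2 i)) (coequalizer.π _ _)) fun i => hG (q.1.2 i)

/-- In a regular category the image of `e` is the coequalizer of its kernel pair, and the kernel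
pair is a subobject of the square of the source. -/
lemma exists_quotientObj_fac [Regular T] {n : ℕ} (φ : Fin n → I) {Y : T}
    (e : (∐ fun i => G (φ i)) ⟶ Y) :
    ∃ (q : QuotientIndex G) (p : (∐ fun i => G (φ i)) ⟶ quotientObj G q)
      (m : quotientObj G q ⟶ Y), Mono m ∧ p ≫ m = e := by
  let R : Subobject ((∐ fun i => G (φ i)) ⨯ (∐ fun i => G (φ i))) :=
    Subobject.mk (prod.lift (pullback.fst e e) (pullback.snd e e))
  let q : QuotientIndex G := ⟨⟨n, φ⟩, equivShrink _ R⟩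
  -- The relation read back from the index `q` equals `R` only propositionally, hence the variable
  -- `A`.
  have hR : ∀ A : Subobject ((∐ fun i => G (φ i)) ⨯ (∐ fun i => G (φ i))), A = R →
      ∃ α : (A : T) ≅ pullback e e, α.hom ≫ pullback.fst e e = A.arrow ≫ prod.fst ∧
        α.hom ≫ pullback.snd e e = A.arrow ≫ prod.snd := by
    rintro _ rfl
    have h := Subobject.underlyingIso_hom_comp_eq_mk
      (prod.lift (pullback.fst e e) (pullback.snd e e))
    refine ⟨Subobject.underlyingIso _, ?_, ?_⟩
    · rw [← h, Category.assoc, prod.lift_fst]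
    · rw [← h, Category.assoc, prod.lift_snd]
  obtain ⟨α, hα₁, hα₂⟩ := hR ((equivShrink _).symm q.2) (by simp [q])
  let p : (∐ fun i => G (φ i)) ⟶ quotientObj G q := coequalizer.π _ _
  have hp : pullback.fst e e ≫ p = pullback.snd e e ≫ p := by
    rw [← cancel_epi α.hom, ← Category.assoc, ← Category.assoc, hα₁, hα₂]
    exact coequalizer.condition _ _
  let θ : quotientObj G q ⟶ coequalizer (pullback.fst e e) (pullback.snd e e) :=
    coequalizer.desc (coequalizer.π _ _) (by
      rw [← hα₁, ← hα₂, Category.assoc, Category.assoc, coequalizer.condition])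
  have hθ : p ≫ θ = coequalizer.π _ _ := coequalizer.π_desc _ _
  have : IsIso θ := by
    refine ⟨coequalizer.desc p hp, ?_, ?_⟩
    · refine coequalizer.hom_ext ?_
      change p ≫ θ ≫ _ = p ≫ 𝟙 _
      rw [← Category.assoc, hθ, coequalizer.π_desc, Category.comp_id]
    · refine coequalizer.hom_ext ?_
      rw [← Category.assoc, coequalizer.π_desc, hθ, Category.comp_id]
  refine ⟨q, p, θ ≫ coequalizer.desc e pullback.condition, mono_comp _ _, ?_⟩
  rw [← Category.assoc, hθ, coequalizer.π_desc]

/-- A morphism from a noetherian object to the localisation of `X` lifts to `X` after replacing its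
source by an isomorphic localisation of a quotient of a finite coproduct of generators. -/
lemma exists_quotientObj_lift [HasFiniteLimits T] (hT : IsTopos T)
    (hG : (ObjectProperty.ofObj G).IsSeparating) {T₀ : Type u₀} [Category.{v} T₀]
    (hT₀ : IsTopos T₀) {j : T ⥤ T₀} {r : T₀ ⥤ T} (adj : j ⊣ r) [PreservesFiniteLimits j] [r.Full]
    [r.Faithful] {D : T₀} [IsNoetherianObject D] {X : T} (d : D ⟶ j.obj X) :
    ∃ (q : QuotientIndex G) (β : D ≅ j.obj (quotientObj G q)) (b : quotientObj G q ⟶ X),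
      β.hom ≫ j.map b = d := by
  have := hT.regular
  have := hT₀.regular
  have := hT₀.balanced
  have := hT₀.hasColimits
  have : HasFiniteColimits T₀ := hasFiniteColimits_of_hasColimitsOfSize T₀
  let W := pullback (r.map d) (adj.unit.app X)
  let c : j.obj W ⟶ D := j.map (pullback.fst (r.map d) (adj.unit.app X)) ≫ adj.counit.app D
  have hc : IsIso c := isIso_map_pullback_fst adj d
  have hcd : c ≫ d = j.map (pullback.snd (r.map d) (adj.unit.app X)) :=
    map_pullback_fst_comp adj d
  have hW : JointlyEpi (fun p : Σ i, (G i ⟶ W) => p.2) := by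
    intro Z a b h
    refine hG _ _ ?_
    rintro _ ⟨i⟩ g
    exact h ⟨i, g⟩
  -- The generators cover `W`, hence their localisations cover `D ≅ j.obj W`, and finitely many
  -- suffice. Their image `m` in `W` then satisfies that `j.map m ≫ c` is mono and epi.
  obtain ⟨n, ψ, hψ⟩ := exists_fin_jointlyEpi ((hW.map_of_adjunction adj).comp_epi c)
  obtain ⟨q, p, m, hm, hpm⟩ := exists_quotientObj_fac G (fun k => (ψ k).1)
    (Sigma.desc (fun k => (ψ k).2))
  have : Epi (j.map m ≫ c) := by
    refine hψ.epi_of_factors _ fun k => ?_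
    refine ⟨j.map (Sigma.ι (fun k => G (ψ k).1) k ≫ p), ?_⟩
    rw [← Category.assoc, ← j.map_comp, Category.assoc, hpm]
    congr 2
    exact Sigma.ι_desc (f := fun k => G (ψ k).1) (fun k => (ψ k).2) k
  have : IsIso (j.map m ≫ c) := isIso_of_mono_of_epi _
  refine ⟨q, (asIso (j.map m ≫ c)).symm, m ≫ pullback.snd _ _, ?_⟩
  rw [Iso.symm_hom, asIso_inv, IsIso.inv_comp_eq, Category.assoc, hcd, j.map_comp]

end NoetherianFamily

end ToposGluing
-- The gluing: colimits, finite limits and adjoints of the projections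
namespace ToposGluing

open Opposite

section Gluing

variable {T₀ : Type u₀} [Category.{v} T₀] {T₁ : Type u₁} [Category.{v} T₁]
  {T₂ : Type u₂} [Category.{v} T₂] (j₁ : T₁ ⥤ T₀) (j₂ : T₂ ⥤ T₀)

open CategoricalPullback

section Squares

variable {j₁ j₂} {A B C : T₁} {A' B' C' : T₂} {f : A ⟶ B} {g : B ⟶ C} {h : A ⟶ C} {f' : A' ⟶ B'}
  {g' : B' ⟶ C'} {h' : A' ⟶ C'} {a : j₁.obj A ⟶ j₂.obj A'} {b : j₁.obj B ⟶ j₂.obj B'}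
  {c : j₁.obj C ⟶ j₂.obj C'}

lemma map_comp_square_left (e : f ≫ g = h) (e' : f' ≫ g' = h')
    (hf : j₁.map f ≫ b = a ≫ j₂.map f') (hh : j₁.map h ≫ c = a ≫ j₂.map h') :
    j₁.map f ≫ j₁.map g ≫ c = j₁.map f ≫ b ≫ j₂.map g' := by
  subst e e'
  rw [← Category.assoc _ b, hf, ← j₁.map_comp_assoc, hh, j₂.map_comp, Category.assoc]

lemma map_comp_square_right (e : f ≫ g = h) (e' : f' ≫ g' = h')
    (hg : j₁.map g ≫ c = b ≫ j₂.map g') (hh : j₁.map h ≫ c = a ≫ j₂.map h') :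
    (j₁.map f ≫ b) ≫ j₂.map g' = (a ≫ j₂.map f') ≫ j₂.map g' := by
  subst e e'
  rw [Category.assoc, ← hg, ← j₁.map_comp_assoc, hh, j₂.map_comp, Category.assoc]

end Squares

section Colimits

variable {j₁ j₂} {K : Type*} [Category* K] (F : K ⥤ CategoricalPullback j₁ j₂)

/-- The comparison of the two diagrams in `T₀` attached to a diagram in the gluing. -/
abbrev diagramIso : (F ⋙ π₁ j₁ j₂) ⋙ j₁ ≅ (F ⋙ π₂ j₁ j₂) ⋙ j₂ :=
  NatIso.ofComponents (fun k => (F.obj k).iso) (fun f => (F.map f).w)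

variable {F}

/-- The cocone in the gluing obtained from colimit cocones of the two projections. -/
noncomputable def glueCocone [PreservesColimit (F ⋙ π₁ j₁ j₂) j₁]
    [PreservesColimit (F ⋙ π₂ j₁ j₂) j₂] {c₁ : Cocone (F ⋙ π₁ j₁ j₂)} (h₁ : IsColimit c₁)
    {c₂ : Cocone (F ⋙ π₂ j₁ j₂)} (h₂ : IsColimit c₂) : Cocone F where
  pt := ⟨c₁.pt, c₂.pt, (isColimitOfPreserves j₁ h₁).coconePointsIsoOfNatIso
    (isColimitOfPreserves j₂ h₂) (diagramIso F)⟩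
  ι :=
    { app k := ⟨c₁.ι.app k, c₂.ι.app k,
        (isColimitOfPreserves j₁ h₁).comp_coconePointsIsoOfNatIso_hom _ _ k⟩
      naturality k l f := by
        ext
        · exact c₁.ι.naturality f
        · exact c₂.ι.naturality f }

/-- The glued cocone is a colimit cocone. -/
noncomputable def isColimitGlueCocone [PreservesColimit (F ⋙ π₁ j₁ j₂) j₁]
    [PreservesColimit (F ⋙ π₂ j₁ j₂) j₂] {c₁ : Cocone (F ⋙ π₁ j₁ j₂)} (h₁ : IsColimit c₁)
    {c₂ : Cocone (F ⋙ π₂ j₁ j₂)} (h₂ : IsColimit c₂) : IsColimit (glueCocone h₁ h₂) where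
  desc s :=
    ⟨h₁.desc ((π₁ j₁ j₂).mapCocone s), h₂.desc ((π₂ j₁ j₂).mapCocone s), by
      refine (isColimitOfPreserves j₁ h₁).hom_ext fun k => ?_
      exact map_comp_square_left (h₁.fac _ k) (h₂.fac _ k) ((glueCocone h₁ h₂).ι.app k).w
        (s.ι.app k).w⟩
  fac s k := by
    ext
    · exact h₁.fac _ k
    · exact h₂.fac _ k
  uniq s m hm := by
    ext
    · exact h₁.uniq ((π₁ j₁ j₂).mapCocone s) _ fun k => congr_arg Hom.fst (hm k)
    · exact h₂.uniq ((π₂ j₁ j₂).mapCocone s) _ fun k => congr_arg Hom.snd (hm k)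

/-- The cone in the gluing obtained from limit cones of the two projections. -/
noncomputable def glueCone [PreservesLimit (F ⋙ π₁ j₁ j₂) j₁]
    [PreservesLimit (F ⋙ π₂ j₁ j₂) j₂] {c₁ : Cone (F ⋙ π₁ j₁ j₂)} (h₁ : IsLimit c₁)
    {c₂ : Cone (F ⋙ π₂ j₁ j₂)} (h₂ : IsLimit c₂) : Cone F where
  pt := ⟨c₁.pt, c₂.pt, (isLimitOfPreserves j₁ h₁).conePointsIsoOfNatIso
    (isLimitOfPreserves j₂ h₂) (diagramIso F)⟩
  π :=
    { app k := ⟨c₁.π.app k, c₂.π.app k,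
        ((isLimitOfPreserves j₁ h₁).conePointsIsoOfNatIso_hom_comp
          (isLimitOfPreserves j₂ h₂) (diagramIso F) k).symm⟩
      naturality k l f := by
        ext
        · exact c₁.π.naturality f
        · exact c₂.π.naturality f }

/-- The glued cone is a limit cone. -/
noncomputable def isLimitGlueCone [PreservesLimit (F ⋙ π₁ j₁ j₂) j₁]
    [PreservesLimit (F ⋙ π₂ j₁ j₂) j₂] {c₁ : Cone (F ⋙ π₁ j₁ j₂)} (h₁ : IsLimit c₁)
    {c₂ : Cone (F ⋙ π₂ j₁ j₂)} (h₂ : IsLimit c₂) : IsLimit (glueCone h₁ h₂) where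
  lift s :=
    ⟨h₁.lift ((π₁ j₁ j₂).mapCone s), h₂.lift ((π₂ j₁ j₂).mapCone s), by
      refine (isLimitOfPreserves j₂ h₂).hom_ext fun k => ?_
      exact map_comp_square_right (h₁.fac _ k) (h₂.fac _ k) ((glueCone h₁ h₂).π.app k).w
        (s.π.app k).w⟩
  fac s k := by
    ext
    · exact h₁.fac _ k
    · exact h₂.fac _ k
  uniq s m hm := by
    ext
    · exact h₁.uniq ((π₁ j₁ j₂).mapCone s) _ fun k => congr_arg Hom.fst (hm k)
    · exact h₂.uniq ((π₂ j₁ j₂).mapCone s) _ fun k => congr_arg Hom.snd (hm k)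

end Colimits

lemma hasColimits_gluing [HasColimitsOfSize.{v, v} T₁] [HasColimitsOfSize.{v, v} T₂]
    [PreservesColimitsOfSize.{v, v} j₁] [PreservesColimitsOfSize.{v, v} j₂] :
    HasColimitsOfSize.{v, v} (CategoricalPullback j₁ j₂) :=
  ⟨fun _ _ => ⟨fun _ => ⟨_, isColimitGlueCocone (colimit.isColimit _) (colimit.isColimit _)⟩⟩⟩

section FiniteLimits

variable [HasFiniteLimits T₁] [HasFiniteLimits T₂] [PreservesFiniteLimits j₁]
  [PreservesFiniteLimits j₂]

lemma hasFiniteLimits_gluing : HasFiniteLimits (CategoricalPullback j₁ j₂) :=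
  ⟨fun _ _ _ => ⟨fun _ => ⟨_, isLimitGlueCone (limit.isLimit _) (limit.isLimit _)⟩⟩⟩

lemma preservesFiniteLimits_π₁ : PreservesFiniteLimits (π₁ j₁ j₂) :=
  ⟨fun _ _ _ => ⟨preservesLimit_of_preserves_limit_cone
    (isLimitGlueCone (limit.isLimit _) (limit.isLimit _)) (limit.isLimit _)⟩⟩

lemma preservesFiniteLimits_π₂ : PreservesFiniteLimits (π₂ j₁ j₂) :=
  ⟨fun _ _ _ => ⟨preservesLimit_of_preserves_limit_cone
    (isLimitGlueCone (limit.isLimit _) (limit.isLimit _)) (limit.isLimit _)⟩⟩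

end FiniteLimits

section Adjunction

variable {j₁ j₂} {r₂ : T₀ ⥤ T₂} (adj : j₂ ⊣ r₂) [r₂.Full] [r₂.Faithful]

/-- The right-hand side is the compatibility square of a morphism into an object `extendFst j₁ adj`;
hence the first component determines the second by transposition. -/
lemma homEquiv_iso_inv_comp_eq_iff {P Q : T₀} {A : T₂} (e : P ≅ j₂.obj A) (f : P ⟶ Q)
    (g : A ⟶ r₂.obj Q) :
    adj.homEquiv _ _ (e.inv ≫ f) = g ↔ f ≫ inv (adj.counit.app Q) = e.hom ≫ j₂.map g := by
  rw [← Equiv.eq_symm_apply, Adjunction.homEquiv_counit, Iso.inv_comp_eq, IsIso.comp_inv_eq,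
    Category.assoc]

variable (j₁) in
/-- The right adjoint of the first projection of the gluing. -/
noncomputable def extendFst : T₁ ⥤ CategoricalPullback j₁ j₂ where
  obj A := ⟨A, r₂.obj (j₁.obj A), (asIso (adj.counit.app (j₁.obj A))).symm⟩
  map {X Y} f := ⟨f, r₂.map (j₁.map f), by
    rw [← cancel_mono (adj.counit.app (j₁.obj Y))]
    simp⟩

/-- The first projection of the gluing is left adjoint to `extendFst`. -/
noncomputable def adjunctionFst : π₁ j₁ j₂ ⊣ extendFst j₁ adj :=
  Adjunction.mkOfHomEquiv
    { homEquiv X A :=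
        { toFun f := ⟨f, adj.homEquiv _ _ (X.iso.inv ≫ j₁.map f),
            (homEquiv_iso_inv_comp_eq_iff adj _ _ _).1 rfl⟩
          invFun f := f.fst
          left_inv f := rfl
          right_inv f := by
            ext
            · rfl
            · exact (homEquiv_iso_inv_comp_eq_iff adj _ _ _).2 f.w }
      homEquiv_naturality_left_symm f g := rfl
      homEquiv_naturality_right {X A B} f g := by
        ext
        · rfl
        · refine Eq.trans (congr_arg (adj.homEquiv _ _) ?_) (adj.homEquiv_naturality_right _ _)
          exact (congr_arg (X.iso.inv ≫ ·) (j₁.map_comp f g)).trans (Category.assoc _ _ _).symm }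

instance : IsIso (adjunctionFst (j₁ := j₁) adj).counit := by
  have (A : T₁) : IsIso ((adjunctionFst (j₁ := j₁) adj).counit.app A) := by
    change IsIso (𝟙 A)
    infer_instance
  exact NatIso.isIso_of_isIso_app _

end Adjunction

end Gluing

end ToposGluing
-- Generators of the gluing and the conclusion
namespace ToposGluing

open CategoricalPullback

/-- Precomposition with a left exact left adjoint. -/
def SheafInverseImage.comp {D : Type u₁} [Category.{v} D] {T : Type u₂} [Category.{v} T]
    (Φ : SheafInverseImage T) (F : D ⥤ T) [F.IsLeftAdjoint] [PreservesFiniteLimits F] :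
    SheafInverseImage D where
  site := Φ.site
  topology := Φ.topology
  functor := F ⋙ Φ.functor
  isLeftAdjoint := inferInstance
  preservesFiniteLimits := comp_preservesFiniteLimits _ _

lemma IsLocalisation.of_adjunction {D : Type u₁} [Category.{v} D] {C : Type u₂} [Category.{v} C]
    {j : D ⥤ C} {r : C ⥤ D} (adj : j ⊣ r) [PreservesFiniteLimits j] [IsIso adj.counit] :
    IsLocalisation j :=
  have h := adj.fullyFaithfulROfIsIsoCounit
  ⟨adj.leftAdjoint_preservesColimits, inferInstance, r, ⟨adj⟩, h.full, h.faithful⟩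

/-- The localised generators separate because `r` is faithful and morphisms out of them transpose to
morphisms out of `G i`. -/
lemma IsLocallySNoetherianTopos.of_isLocalisation {T₁ : Type u₁} [Category.{v} T₁] {T₀ : Type u₀}
    [Category.{v} T₀] (h₁ : IsLocallySNoetherianTopos T₁) (h₀ : IsTopos T₀) {j : T₁ ⥤ T₀}
    (hj : IsLocalisation j) : IsLocallySNoetherianTopos T₀ := by
  obtain ⟨hT, I, G, hG, hN⟩ := h₁
  obtain ⟨_, _, r, ⟨adj⟩, _, _⟩ := hj
  have := hT.hasLimits
  have := h₀.hasLimits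
  have : HasFiniteLimits T₁ := hasFiniteLimits_of_hasLimitsOfSize T₁
  have : HasFiniteLimits T₀ := hasFiniteLimits_of_hasLimitsOfSize T₀
  refine ⟨h₀, I, fun i => j.obj (G i), fun X Y f g h => r.map_injective (hG _ _ ?_), fun i => ?_⟩
  · rintro _ ⟨i⟩ a
    apply (adj.homEquiv _ _).symm.injective
    rw [adj.homEquiv_naturality_right_symm, adj.homEquiv_naturality_right_symm]
    exact h _ ⟨i⟩ _
  · have := hN i
    exact isNoetherianObject_obj adj (G i)

/-- Needed for `QuotientIndex` to be small; in a balanced category separating families are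
detecting. -/
lemma IsLocallySNoetherianTopos.wellPowered {T : Type u} [Category.{v} T]
    (hT : IsLocallySNoetherianTopos T) : WellPowered.{v} T := by
  obtain ⟨hT, I, G, hG, -⟩ := hT
  have := hT.hasLimits
  have : HasFiniteLimits T := hasFiniteLimits_of_hasLimitsOfSize T
  have := hT.balanced
  exact wellPowered_of_isDetecting hG.isDetecting

lemma isSeparating_ofObj_sumElim {T : Type u} [Category.{v} T] {I J : Type*} (A : I → T) (B : J → T)
    (h : ∀ ⦃X Y : T⦄ (f g : X ⟶ Y), (∀ i (a : A i ⟶ X), a ≫ f = a ≫ g) →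
      (∀ i (b : B i ⟶ X), b ≫ f = b ≫ g) → f = g) :
    (ObjectProperty.ofObj (Sum.elim A B)).IsSeparating :=
  fun _ _ f g hfg => h f g (fun i => hfg _ ⟨Sum.inl i⟩) (fun i => hfg _ ⟨Sum.inr i⟩)

section MapSubobject

variable {D : Type u₁} [Category.{v} D] {C : Type u₂} [Category.{v} C] (F : D ⥤ C)
  [F.PreservesMonomorphisms]

/-- The action of a functor preserving monomorphisms on subobjects. -/
noncomputable def mapSubobject (X : D) : Subobject X →o Subobject (F.obj X) where
  toFun S := Subobject.mk (F.map S.arrow)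
  monotone' S S' h := Subobject.mk_le_mk_of_comm (F.map (Subobject.ofLE S S' h)) (by
    rw [← F.map_comp, Subobject.ofLE_arrow])

lemma isIso_map_ofLE {X : D} {S S' : Subobject X} (h : S ≤ S')
    (hF : mapSubobject F X S = mapSubobject F X S') : IsIso (F.map (Subobject.ofLE S S' h)) := by
  have : F.map (Subobject.ofLE S S' h) =
      (Subobject.isoOfMkEqMk (F.map S.arrow) (F.map S'.arrow) hF).hom := by
    rw [← cancel_mono (F.map S'.arrow), ← F.map_comp, Subobject.ofLE_arrow]
    exact (Subobject.ofMkLEMk_comp hF.le).symm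
  rw [this]
  infer_instance

end MapSubobject

section Gluing

variable {T₀ : Type u₀} [Category.{v} T₀] {T₁ : Type u₁} [Category.{v} T₁]
  {T₂ : Type u₂} [Category.{v} T₂] {j₁ : T₁ ⥤ T₀} {j₂ : T₂ ⥤ T₀}

/-- Isomorphisms of the gluing are detected on components, so subobjects map strictly monotonically
to pairs of subobjects. -/
lemma isNoetherianObject_gluing [PreservesFiniteLimits (π₁ j₁ j₂)] [PreservesFiniteLimits (π₂ j₁ j₂)]
    (X : CategoricalPullback j₁ j₂) (h₁ : IsNoetherianObject X.fst)
    (h₂ : IsNoetherianObject X.snd) : IsNoetherianObject X := by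
  have : WellFoundedGT (Subobject ((π₁ j₁ j₂).obj X)) := isNoetherianObject.prop_of_is X.fst
  have : WellFoundedGT (Subobject ((π₂ j₁ j₂).obj X)) := isNoetherianObject.prop_of_is X.snd
  have h : StrictMono fun S : Subobject X =>
      (mapSubobject (π₁ j₁ j₂) X S, mapSubobject (π₂ j₁ j₂) X S) := by
    intro S S' hS
    refine lt_of_le_of_ne ⟨(mapSubobject _ X).monotone hS.le, (mapSubobject _ X).monotone hS.le⟩
      fun e => hS.ne ?_
    obtain ⟨e₁, e₂⟩ := Prod.ext_iff.1 e
    have : IsIso (Subobject.ofLE S S' hS.le) := (CategoricalPullback.isIso_iff j₁ j₂ _).2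
      ⟨isIso_map_ofLE (π₁ j₁ j₂) hS.le e₁, isIso_map_ofLE (π₂ j₁ j₂) hS.le e₂⟩
    exact le_antisymm hS.le (Subobject.le_of_comm (inv (Subobject.ofLE S S' hS.le)) (by simp))
  exact ⟨h.wellFoundedGT⟩

variable (j₁ j₂) in
/-- The symmetry of the gluing. -/
def swapFunctor : CategoricalPullback j₁ j₂ ⥤ CategoricalPullback j₂ j₁ where
  obj X := ⟨X.snd, X.fst, X.iso.symm⟩
  map f := ⟨f.snd, f.fst, by simp⟩

variable (j₁ j₂) in
/-- The symmetry of the gluing. -/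
def swapEquivalence : CategoricalPullback j₁ j₂ ≌ CategoricalPullback j₂ j₁ where
  functor := swapFunctor j₁ j₂
  inverse := swapFunctor j₂ j₁
  unitIso := Iso.refl _
  counitIso := Iso.refl _
  functor_unitIso_comp _ := Category.comp_id _

lemma isLocalisation_π₁ [HasFiniteLimits T₁] [HasFiniteLimits T₂] [PreservesFiniteLimits j₁]
    (hj₂ : IsLocalisation j₂) : IsLocalisation (π₁ j₁ j₂) := by
  obtain ⟨_, _, r₂, ⟨adj⟩, _, _⟩ := hj₂
  have := preservesFiniteLimits_π₁ j₁ j₂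
  exact .of_adjunction (adjunctionFst (j₁ := j₁) adj)

lemma isLocalisation_π₂ [HasFiniteLimits T₁] [HasFiniteLimits T₂] [PreservesFiniteLimits j₂]
    (hj₁ : IsLocalisation j₁) : IsLocalisation (π₂ j₁ j₂) := by
  obtain ⟨_, _, r₁, ⟨adj⟩, _, _⟩ := hj₁
  have := preservesFiniteLimits_π₂ j₁ j₂
  let adj' : π₂ j₁ j₂ ⊣ extendFst j₂ adj ⋙ swapFunctor j₂ j₁ :=
    (swapEquivalence j₁ j₂).toAdjunction.comp (adjunctionFst (j₁ := j₂) adj)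
  have h := (adjunctionFst (j₁ := j₂) adj).fullyFaithfulROfIsIsoCounit
  have h' := h.comp (swapEquivalence j₂ j₁).fullyFaithfulFunctor
  exact ⟨adj'.leftAdjoint_preservesColimits, inferInstance, _, ⟨adj'⟩, h'.full, h'.faithful⟩

/-- A separating family of noetherian objects of the gluing. -/
lemma exists_generators_gluing (h₀ : IsTopos T₀) (h₁ : IsLocallySNoetherianTopos T₁)
    (h₂ : IsLocallySNoetherianTopos T₂) (hj₁ : IsLocalisation j₁) (hj₂ : IsLocalisation j₂) :
    ∃ (I : Type v) (G : I → CategoricalPullback j₁ j₂),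
      (ObjectProperty.ofObj G).IsSeparating ∧
        ∀ i, IsNoetherianObject (G i).fst ∧ IsNoetherianObject (G i).snd := by
  have := h₁.wellPowered
  have := h₂.wellPowered
  obtain ⟨hT₁, I₁, G₁, hG₁, hN₁⟩ := h₁
  obtain ⟨hT₂, I₂, G₂, hG₂, hN₂⟩ := h₂
  obtain ⟨_, _, r₁, ⟨adj₁⟩, _, _⟩ := hj₁
  obtain ⟨_, _, r₂, ⟨adj₂⟩, _, _⟩ := hj₂
  have := h₀.hasLimits
  have := hT₁.hasLimits
  have := hT₂.hasLimits
  have := hT₁.hasColimits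
  have := hT₂.hasColimits
  have : HasFiniteLimits T₀ := hasFiniteLimits_of_hasLimitsOfSize T₀
  have : HasFiniteLimits T₁ := hasFiniteLimits_of_hasLimitsOfSize T₁
  have : HasFiniteLimits T₂ := hasFiniteLimits_of_hasLimitsOfSize T₂
  have : HasFiniteColimits T₁ := hasFiniteColimits_of_hasColimitsOfSize T₁
  have : HasFiniteColimits T₂ := hasFiniteColimits_of_hasColimitsOfSize T₂
  -- All gluing isomorphisms are included in the index; they form a set in `Type v`.
  refine ⟨(Σ (i : I₁) (q : QuotientIndex G₂), j₁.obj (G₁ i) ≅ j₂.obj (quotientObj G₂ q)) ⊕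
      (Σ (i : I₂) (q : QuotientIndex G₁), j₂.obj (G₂ i) ≅ j₁.obj (quotientObj G₁ q)),
    Sum.elim (fun p => ⟨G₁ p.1, quotientObj G₂ p.2.1, p.2.2⟩)
      (fun p => ⟨quotientObj G₁ p.2.1, G₂ p.1, p.2.2.symm⟩), ?_, ?_⟩
  · refine isSeparating_ofObj_sumElim _ _ fun X Y f g h h' => ?_
    ext
    · refine hG₁ _ _ ?_
      rintro _ ⟨i⟩ a
      have := hN₁ i
      have := isNoetherianObject_obj adj₁ (G₁ i)
      -- This produces the second component completing `a` to a morphism of the gluing.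
      obtain ⟨q, β, b, hb⟩ :=
        exists_quotientObj_lift G₂ hT₂ hG₂ h₀ adj₂ (j₁.map a ≫ X.iso.hom)
      let c : (⟨G₁ i, quotientObj G₂ q, β⟩ : CategoricalPullback j₁ j₂) ⟶ X := ⟨a, b, hb.symm⟩
      exact congr_arg Hom.fst (h ⟨i, q, β⟩ c)
    · refine hG₂ _ _ ?_
      rintro _ ⟨i⟩ a
      have := hN₂ i
      have := isNoetherianObject_obj adj₂ (G₂ i)
      obtain ⟨q, β, b, hb⟩ :=
        exists_quotientObj_lift G₁ hT₁ hG₁ h₀ adj₁ (j₂.map a ≫ X.iso.inv)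
      let c : (⟨quotientObj G₁ q, G₂ i, β.symm⟩ : CategoricalPullback j₁ j₂) ⟶ X := ⟨b, a, by
        rw [Iso.symm_hom, ← Iso.eq_comp_inv, Category.assoc, ← hb, Iso.inv_hom_id_assoc]⟩
      exact congr_arg Hom.snd (h' ⟨i, q, β⟩ c)
  · rintro (p | p)
    · exact ⟨hN₁ _, isNoetherianObject_quotientObj G₂ hT₂ hN₂ _⟩
    · exact ⟨isNoetherianObject_quotientObj G₁ hT₁ hN₁ _, hN₂ _⟩

lemma isConservativeFamily_gluing [PreservesFiniteLimits (π₁ j₁ j₂)]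
    [PreservesFiniteLimits (π₂ j₁ j₂)] [(π₁ j₁ j₂).IsLeftAdjoint] [(π₂ j₁ j₂).IsLeftAdjoint]
    (Φ₁ : SheafInverseImage T₁) [Φ₁.functor.ReflectsIsomorphisms]
    (Φ₂ : SheafInverseImage T₂) [Φ₂.functor.ReflectsIsomorphisms] :
    IsConservativeFamily
      (fun b : Bool => cond b (Φ₁.comp (π₁ j₁ j₂)) (Φ₂.comp (π₂ j₁ j₂))) := by
  intro X Y f hf
  rw [CategoricalPullback.isIso_iff]
  have hf₁ : IsIso (Φ₁.functor.map f.fst) := hf true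
  have hf₂ : IsIso (Φ₂.functor.map f.snd) := hf false
  exact ⟨isIso_of_reflects_iso _ Φ₁.functor, isIso_of_reflects_iso _ Φ₂.functor⟩

lemma isLocallySNoetherianTopos_gluing (h₀ : IsTopos T₀) (h₁ : IsLocallySNoetherianTopos T₁)
    (h₂ : IsLocallySNoetherianTopos T₂) (hj₁ : IsLocalisation j₁) (hj₂ : IsLocalisation j₂) :
    IsLocallySNoetherianTopos (CategoricalPullback j₁ j₂) := by
  obtain ⟨I, G, hG, hN⟩ := exists_generators_gluing h₀ h₁ h₂ hj₁ hj₂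
  have := h₁.isTopos.hasLimits
  have := h₂.isTopos.hasLimits
  have := h₁.isTopos.hasColimits
  have := h₂.isTopos.hasColimits
  have : HasFiniteLimits T₁ := hasFiniteLimits_of_hasLimitsOfSize T₁
  have : HasFiniteLimits T₂ := hasFiniteLimits_of_hasLimitsOfSize T₂
  have := hj₁.preservesFiniteLimits
  have := hj₂.preservesFiniteLimits
  have := hj₁.preservesColimits
  have := hj₂.preservesColimits
  have := hasColimits_gluing j₁ j₂
  have := hasFiniteLimits_gluing j₁ j₂
  have := preservesFiniteLimits_π₁ j₁ j₂
  have := preservesFiniteLimits_π₂ j₁ j₂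
  obtain ⟨_, ⟨adj₁⟩, _, _⟩ := (isLocalisation_π₁ (j₁ := j₁) hj₂).exists_rightAdjoint
  obtain ⟨_, ⟨adj₂⟩, _, _⟩ := (isLocalisation_π₂ (j₂ := j₂) hj₁).exists_rightAdjoint
  have := adj₁.isLeftAdjoint
  have := adj₂.isLeftAdjoint
  obtain ⟨Φ₁, _⟩ := h₁.isTopos.exists_sheafInverseImage
  obtain ⟨Φ₂, _⟩ := h₂.isTopos.exists_sheafInverseImage
  exact ⟨isTopos_of_isSeparating (isConservativeFamily_gluing Φ₁ Φ₂) G hG, I, G, hG,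
    fun i => isNoetherianObject_gluing _ (hN i).1 (hN i).2⟩

end Gluing

end ToposGluing


/-- The gluing of `T₁` and `T₂` along `T₀` is the category of triples `(A₁, A₂, α)` with
`α : j₁ A₁ ≅ j₂ A₂`, which is Mathlib's `CategoricalPullback j₁ j₂`. -/
theorem mainTheorem6 {T₀ : Type u₀} [Category.{v} T₀] {T₁ : Type u₁} [Category.{v} T₁]
    {T₂ : Type u₂} [Category.{v} T₂]
    (h₀ : ToposGluing.IsTopos T₀)
    (h₁ : ToposGluing.IsLocallySNoetherianTopos T₁)
    (h₂ : ToposGluing.IsLocallySNoetherianTopos T₂)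
    (j₁ : T₁ ⥤ T₀) (j₂ : T₂ ⥤ T₀)
    (hj₁ : ToposGluing.IsLocalisation j₁) (hj₂ : ToposGluing.IsLocalisation j₂) :
    ToposGluing.IsLocallySNoetherianTopos (CategoricalPullback j₁ j₂) ∧
      ToposGluing.IsLocallySNoetherianTopos T₀ ∧
      ToposGluing.IsLocalisation (CategoricalPullback.π₁ j₁ j₂) ∧
      ToposGluing.IsLocalisation (CategoricalPullback.π₂ j₁ j₂) := by
  have := h₁.isTopos.hasLimits
  have := h₂.isTopos.hasLimits
  have : HasFiniteLimits T₁ := hasFiniteLimits_of_hasLimitsOfSize T₁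
  have : HasFiniteLimits T₂ := hasFiniteLimits_of_hasLimitsOfSize T₂
  have := hj₁.preservesFiniteLimits
  have := hj₂.preservesFiniteLimits
  exact ⟨ToposGluing.isLocallySNoetherianTopos_gluing h₀ h₁ h₂ hj₁ hj₂,
    h₁.of_isLocalisation h₀ hj₁, ToposGluing.isLocalisation_π₁ hj₂,
    ToposGluing.isLocalisation_π₂ hj₁⟩
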